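/- Let $R_k\in M_2(\mathbb Z)$, $k\ge 1$, be expanding matrices (all complex eigenvalues have modulus $>1$), and let $D_k=\{(0,0)^t,(a_k,b_k)^t,(c_k,d_k)^t\}\subset\mathbb Z^2$, $k\ge1$, be digit sets with $|a_kd_k-b_kc_k|=1$ and $D_k\in\Gamma_1\cup\Gamma_2$, where $$\Gamma_1=\bigl\{\{(0,0)^t,(a,b)^t,(c,d)^t\}:\ -d-c\equiv a+b \pmod 3\bigr\},\qquad \Gamma_2=\bigl\{\{(0,0)^t,(a,b)^t,(c,d)^t\}:\ d-c\equiv a-b \pmod 3\bigr\}$$ (with $a,b,c,d\in\mathbb Z$). For a finite nonempty $D\subset\mathbb Z^2$ let $m_D(\xi)=\frac1{\#D}\sum_{d\in D}e^{2\pi i\langle\xi,d\rangle}$ and $\mathcal Z(m_D)=\{\xi\in\mathbb R^2: m_D(\xi)=0\}$; for finite nonempty $E\subset\mathbb R^2$ let $\delta_E=\frac1{\#E}\sum_{e\in E}\delta_e$. With $\|\cdot\|$ the Euclidean norm and $\|A\|'=\sup_{x\ne0}\|Ax\|/\|x\|$, assume: (1) $\limsup_{k\to\infty}\|R_k^{-1}\|'<1$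 and $\sup\{\|d\|: d\in D_k,\ k\ge1\}<\infty$; (2) there are $\delta,\beta\in(0,\frac14)$ and $N\in\mathbb N$ such that for all $k>N$ and $p\ge1$ the matrix $A=R_{k+1}^tR_{k+2}^t\cdots R_{k+p}^t$ satisfies $$A^{-1}\bigl[-\tfrac12-\delta,\tfrac12+\delta\bigr]^2\cap\Bigl(\bigcup_{j\ge1}\mathcal Z(m_{D_j})\Bigr)_\beta=\emptyset,\qquad\text{where } E_\beta=\{x:\ \|x-y\|<\beta\text{ for some }y\in E\}.$$ Then the finite convolutions $\delta_{R_1^{-1}D_1}*\delta_{R_1^{-1}R_2^{-1}D_2}*\cdots*\delta_{R_1^{-1}\cdots R_l^{-1}D_l}$ converge weakly, as $l\to\infty$, to a unique Borel probability measure $\mu$ on $\mathbb R^2$. This $\mu$ is a spectral measure (that is, there is a countable $\Lambda\subset\mathbb R^2$ such that $\{e^{-2\pi i\langle\lambda,x\rangle}:\lambda\in\Lambda\}$ is an orthonormal basis of $L^2(\mu)$) if and only if, for every $k\ge2$ and every $i\in\{1,2\}$ with $D_k\in\Gamma_i$, the row vector $\frac13(1,i)R_k$ has integer entries. -/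

import Mathlib

open MeasureTheory Filter Topology
open scoped ENNReal

noncomputable section

/-- The integer vector `d`, seen as a point of Euclidean `n`-space. -/
def intVec {n : ℕ} (d : Fin n → ℤ) : EuclideanSpace ℝ (Fin n) :=
  WithLp.toLp 2 (fun i => (d i : ℝ))

/-- The real matrix with the same entries as the integer matrix `A`. -/
def realMat {n : ℕ} (A : Matrix (Fin n) (Fin n) ℤ) : Matrix (Fin n) (Fin n) ℝ :=
  A.map (Int.cast : ℤ → ℝ)

/-- The linear map `x ↦ A x` of Euclidean `n`-space; its norm is `sup_{x ≠ 0} ‖A x‖ / ‖x‖`. -/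
def matMap {n : ℕ} (A : Matrix (Fin n) (Fin n) ℝ) :
    EuclideanSpace ℝ (Fin n) →L[ℝ] EuclideanSpace ℝ (Fin n) :=
  Matrix.toEuclideanCLM (n := Fin n) (𝕜 := ℝ) A

/-- All (complex) eigenvalues of the integer matrix have modulus greater than one. -/
def IsExpanding {n : ℕ} (A : Matrix (Fin n) (Fin n) ℤ) : Prop :=
  ∀ z ∈ spectrum ℂ (A.map (Int.cast : ℤ → ℂ)), 1 < ‖z‖

/-- The uniform probability measure `δ_E = (1 / #E) ∑_{a ∈ E} δ_a` on a nonempty finite set `E`. -/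
def discreteMeasure {n : ℕ} (E : Finset (EuclideanSpace ℝ (Fin n))) (hE : E.Nonempty) :
    ProbabilityMeasure (EuclideanSpace ℝ (Fin n)) :=
  ⟨(E.card : ℝ≥0∞)⁻¹ • ∑ a ∈ E, Measure.dirac a, ⟨by
    have h0 : (E.card : ℝ≥0∞) ≠ 0 := by exact_mod_cast hE.card_ne_zero
    simp [ENNReal.inv_mul_cancel h0 (ENNReal.natCast_ne_top _)]⟩⟩

/-- The product `R₁⁻¹ R₂⁻¹ ⋯ Rₗ⁻¹` (the entry of `R` with index `0` is not used). -/
def invProd {n : ℕ} (R : ℕ → Matrix (Fin n) (Fin n) ℤ) : ℕ → Matrix (Fin n) (Fin n) ℝ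
  | 0 => 1
  | l + 1 => invProd R l * (realMat (R (l + 1)))⁻¹

open Classical in
/-- The measure `δ_{R₁⁻¹ R₂⁻¹ ⋯ Rₖ⁻¹ Dₖ}`. -/
def moranFactor {n : ℕ} (R : ℕ → Matrix (Fin n) (Fin n) ℤ) (D : ℕ → Finset (Fin n → ℤ))
    (hD : ∀ k, (D k).Nonempty) (k : ℕ) : ProbabilityMeasure (EuclideanSpace ℝ (Fin n)) :=
  discreteMeasure ((D k).image fun d => matMap (invProd R k) (intVec d)) ((hD k).image _)

/-- The finite convolution
`δ_{R₁⁻¹ D₁} ∗ δ_{R₁⁻¹ R₂⁻¹ D₂} ∗ ⋯ ∗ δ_{R₁⁻¹ ⋯ Rₗ⁻¹ Dₗ}`; the empty one is the unit mass at `0`. -/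
def moranPartial {n : ℕ} (R : ℕ → Matrix (Fin n) (Fin n) ℤ) (D : ℕ → Finset (Fin n → ℤ))
    (hD : ∀ k, (D k).Nonempty) : ℕ → ProbabilityMeasure (EuclideanSpace ℝ (Fin n))
  | 0 => ⟨Measure.dirac 0, inferInstance⟩
  | l + 1 =>
    ⟨Measure.conv (moranPartial R D hD l : Measure (EuclideanSpace ℝ (Fin n)))
      (moranFactor R D hD (l + 1) : Measure (EuclideanSpace ℝ (Fin n))), inferInstance⟩

/-- `μ` is the infinite convolution `δ_{R₁⁻¹ D₁} ∗ δ_{R₁⁻¹ R₂⁻¹ D₂} ∗ ⋯`, i.e. the weak limit of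
the finite convolutions. -/
def IsMoranMeasure {n : ℕ} (R : ℕ → Matrix (Fin n) (Fin n) ℤ) (D : ℕ → Finset (Fin n → ℤ))
    (hD : ∀ k, (D k).Nonempty) (μ : ProbabilityMeasure (EuclideanSpace ℝ (Fin n))) : Prop :=
  Tendsto (moranPartial R D hD) atTop (𝓝 μ)

/-- `Λ` is a countable set whose exponentials `x ↦ e^{-2 π i ⟨l, x⟩}`, `l ∈ Λ`, form an
orthonormal basis of `L²(μ)`. -/
def IsSpectrum {n : ℕ} (μ : Measure (EuclideanSpace ℝ (Fin n)))
    (Λ : Set (EuclideanSpace ℝ (Fin n))) : Prop :=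
  Λ.Countable ∧ ∃ b : HilbertBasis Λ ℂ (Lp ℂ 2 μ), ∀ l : Λ,
    (b l : EuclideanSpace ℝ (Fin n) → ℂ) =ᵐ[μ] fun x =>
      Complex.exp (-(2 * (Real.pi : ℂ) * Complex.I *
        ((inner ℝ (l : EuclideanSpace ℝ (Fin n)) x : ℝ) : ℂ)))

/-- `μ` has a spectrum. -/
def IsSpectralMeasure {n : ℕ} (μ : Measure (EuclideanSpace ℝ (Fin n))) : Prop :=
  ∃ Λ : Set (EuclideanSpace ℝ (Fin n)), IsSpectrum μ Λ

/-- The mask polynomial `m_D(ξ) = (1 / #D) ∑_{d ∈ D} e^{2 π i ⟨ξ, d⟩}`. -/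
def mask {n : ℕ} (D : Finset (Fin n → ℤ)) (ξ : EuclideanSpace ℝ (Fin n)) : ℂ :=
  (1 / (D.card : ℂ)) * ∑ d ∈ D,
    Complex.exp (2 * (Real.pi : ℂ) * Complex.I * ((inner ℝ ξ (intVec d) : ℝ) : ℂ))

/-- The zero set of the mask polynomial. -/
def maskZeros {n : ℕ} (D : Finset (Fin n → ℤ)) : Set (EuclideanSpace ℝ (Fin n)) :=
  {ξ | mask D ξ = 0}

/-- `limsup ‖Rₖ⁻¹‖ < 1`, and the digits are bounded. -/
def MoranBounded {n : ℕ} (R : ℕ → Matrix (Fin n) (Fin n) ℤ) (D : ℕ → Finset (Fin n → ℤ)) : Prop :=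
  limsup (fun k => ‖matMap (realMat (R k))⁻¹‖ₑ) atTop < 1 ∧
    ∃ B : ℝ, ∀ k, 1 ≤ k → ∀ d ∈ D k, ‖intVec d‖ ≤ B

/-- The cube `[-1/2 - δ, 1/2 + δ]ⁿ`. -/
def cube (n : ℕ) (δ : ℝ) : Set (EuclideanSpace ℝ (Fin n)) :=
  {x | ∀ i, x i ∈ Set.Icc (-(1 / 2) - δ) (1 / 2 + δ)}

/-- The set of (nonsingular) integer matrices `A` for which `A⁻¹ [-1/2 - δ, 1/2 + δ]ⁿ` does not
meet the `β`-neighbourhood of the union of the zero sets of the masks of `D₁, D₂, …`. -/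
def admissibleMatrices {n : ℕ} (D : ℕ → Finset (Fin n → ℤ)) (δ β : ℝ) :
    Set (Matrix (Fin n) (Fin n) ℤ) :=
  {A | A.det ≠ 0 ∧
    (matMap (realMat A)⁻¹ '' cube n δ) ∩
      Metric.thickening β (⋃ k, ⋃ (_ : 1 ≤ k), maskZeros (D k)) = ∅}

/-- For some `δ, β ∈ (0, 1/4)` and some `N`, every product `Rₖ₊₁ᵗ Rₖ₊₂ᵗ ⋯ Rₖ₊ₚᵗ` with `k > N` and
`p ≥ 1` factors is in `admissibleMatrices D δ β`. -/
def MoranSeparated {n : ℕ} (R : ℕ → Matrix (Fin n) (Fin n) ℤ)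
    (D : ℕ → Finset (Fin n → ℤ)) : Prop :=
  ∃ δ ∈ Set.Ioo (0 : ℝ) (1 / 4), ∃ β ∈ Set.Ioo (0 : ℝ) (1 / 4), ∃ N : ℕ,
    ∀ k, N < k → ∀ p, 1 ≤ p →
      ((List.range p).map fun j => (R (k + 1 + j)).transpose).prod ∈ admissibleMatrices D δ β

/-- The digit set `{(0,0), (a,b), (c,d)}`. -/
def triDigits (a b c d : ℤ) : Finset (Fin 2 → ℤ) :=
  {![0, 0], ![a, b], ![c, d]}

theorem triDigits_nonempty (a b c d : ℤ) : (triDigits a b c d).Nonempty :=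
  Finset.insert_nonempty _ _

/-- The digit sets `{(0,0), (a,b), (c,d)}` with `-d - c ≡ a + b (mod 3)`. -/
def Gamma1 : Set (Finset (Fin 2 → ℤ)) :=
  {S | ∃ a b c d : ℤ, S = triDigits a b c d ∧ -d - c ≡ a + b [ZMOD 3]}

/-- The digit sets `{(0,0), (a,b), (c,d)}` with `d - c ≡ a - b (mod 3)`. -/
def Gamma2 : Set (Finset (Fin 2 → ℤ)) :=
  {S | ∃ a b c d : ℤ, S = triDigits a b c d ∧ d - c ≡ a - b [ZMOD 3]}

/-- The row vector `(1/3) (1, i) A` has integer entries. -/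
def ThirdRowIntegral (i : ℕ) (A : Matrix (Fin 2) (Fin 2) ℤ) : Prop :=
  ∃ z : Fin 2 → ℤ,
    (1 / 3 : ℝ) • Matrix.vecMul ![(1 : ℝ), (i : ℝ)] (realMat A) = fun j => (z j : ℝ)

end

/-! The Fourier transform of `μ` is an infinite product of masks, `∏ⱼ m_{Dⱼ}((R₁ᵗ⋯Rⱼᵗ)⁻¹ ξ)`.
Orthogonality of exponentials means that differences of frequencies are zeros of this product. Since
exponentials are total in `L²(μ)`, an orthogonal family with frequencies in `Λ` is a basis exactly
when `∑ |μ̂(ξ + λ)|² = 1` for all `ξ`. The rest concerns such sums.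

The determinant condition and membership in the class `i` say that `|m_D|²` is `ℤ²`-periodic, that
its three translates by multiples of `(1, i)/3` add up to `1`, and that its zeros are congruent to
`±(1, i)/3` modulo `ℤ²` (`triMask_triDigits`).

Necessity. Translate a spectrum so that it contains `0` and rescale it by `(R₁ᵗ)⁻¹`; it then lies in
`ℤ²/3` and is a spectrum for `m G`, with `m` the first squared mask and `G` the remaining product.
Split it into nine residue classes, grouped into the three cosets of the line through `(1, i)`. One
class from each coset gives an orthogonal set for `G`, so its sum is at most `1` by Bessel, while
Parseval for `m G` is a weighted average of these sums with positive weights. Hence every selection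
is a spectrum for `G`, and classes in one coset have equal sums (`TriMask.exists_countable_split`).
At the next level a selection containing `0` must also contain a point congruent to `(1, i₂)`.
Pulled back by `Aᵗ`, where `A` is the next matrix, this point lies in every admissible selection,
which is possible only if `Aᵗ(1, i₂)` vanishes modulo `3`. The selected set, rescaled, restarts the
argument one level further.

Sufficiency. Divisibility makes the first `l` masks blind to the three translates that the next mask
needs, so finite spectra extend from level to level (`IsFiniteSpectrum.exists_succ`). Modulo periods
they can be kept in the rescaled unit cube, where the separation hypothesis bounds the tail product
below (`ContractingMoran.exists_le_norm_maskLimit`). Dominated convergence carries Parseval to the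
union. -/

noncomputable section

/-- A form of Lévy's continuity theorem: if the characteristic functions converge pointwise to a
function that is continuous at the origin, the measures converge weakly. -/
theorem exists_tendsto_of_tendsto_charFun {E : Type*} [NormedAddCommGroup E]
    [InnerProductSpace ℝ E] [FiniteDimensional ℝ E] [MeasurableSpace E] [BorelSpace E]
    {μ : ℕ → ProbabilityMeasure E} {f : E → ℂ} (hf : ContinuousAt f 0)
    (h : ∀ t, Tendsto (fun n => charFun (μ n : Measure E) t) atTop (𝓝 (f t))) :
    ∃ μ₀ : ProbabilityMeasure E, Tendsto μ atTop (𝓝 μ₀) := by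
  have ht : IsTightMeasureSet {(μ n : Measure E) | n} :=
    isTightMeasureSet_of_tendsto_charFun (μ := fun n => (μ n : Measure E)) hf h
  have hc : IsCompact (closure {μ n | n}) :=
    isCompact_closure_of_isTightMeasureSet (by simpa using ht)
  -- Tightness gives a limit only along an ultrafilter, but its characteristic function must be `f`,
  -- and this identifies the limit of the whole sequence.
  let U : Ultrafilter ℕ := Ultrafilter.of atTop
  have hU : (U : Filter ℕ) ≤ atTop := Ultrafilter.of_le atTop
  obtain ⟨μ', -, hμ'⟩ := hc.ultrafilter_le_nhds (U.map μ)
    (.trans (by simp) (monotone_principal subset_closure))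
  have hμ'' : Tendsto μ U (𝓝 μ') := hμ'
  refine ⟨μ', ProbabilityMeasure.tendsto_of_tendsto_charFun fun t => ?_⟩
  have h1 : Tendsto (fun n => charFun (μ n : Measure E) t) U (𝓝 (charFun (μ' : Measure E) t)) := by
    rw [ProbabilityMeasure.tendsto_iff_forall_integral_rclike_tendsto ℂ] at hμ''
    simp_rw [charFun_eq_integral_innerProbChar]
    exact hμ'' (BoundedContinuousFunction.innerProbChar t)
  rw [tendsto_nhds_unique h1 ((h t).mono_left hU)]
  exact h t

/-! ### Matrices acting on Euclidean space -/

variable {n : ℕ}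

theorem matMap_mul (A B : Matrix (Fin n) (Fin n) ℝ) : matMap (A * B) = matMap A * matMap B :=
  map_mul (Matrix.toEuclideanCLM (n := Fin n) (𝕜 := ℝ)) A B

theorem matMap_one : matMap (1 : Matrix (Fin n) (Fin n) ℝ) = 1 :=
  map_one (Matrix.toEuclideanCLM (n := Fin n) (𝕜 := ℝ))

theorem matMap_transpose (A : Matrix (Fin n) (Fin n) ℝ) :
    matMap A.transpose = ContinuousLinearMap.adjoint (matMap A) := by
  rw [← ContinuousLinearMap.star_eq_adjoint]
  unfold matMap
  rw [← map_star, Matrix.star_eq_conjTranspose, Matrix.conjTranspose_eq_transpose_of_trivial]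

theorem norm_matMap_transpose (A : Matrix (Fin n) (Fin n) ℝ) :
    ‖matMap A.transpose‖ = ‖matMap A‖ := by
  rw [matMap_transpose]; exact LinearIsometryEquiv.norm_map _ _

theorem inner_matMap (A : Matrix (Fin n) (Fin n) ℝ) (x y : EuclideanSpace ℝ (Fin n)) :
    inner ℝ (matMap A x) y = inner ℝ x (matMap A.transpose y) := by
  rw [matMap_transpose, ContinuousLinearMap.adjoint_inner_right]

theorem matMap_realMat_intVec (A : Matrix (Fin n) (Fin n) ℤ) (z : Fin n → ℤ) :
    matMap (realMat A) (intVec z) = intVec (A.mulVec z) := by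
  ext i
  simp [matMap, intVec, realMat, Matrix.mulVec, dotProduct]

theorem intVec_add (z w : Fin n → ℤ) : intVec (z + w) = intVec z + intVec w := by
  ext i; simp [intVec]

theorem intVec_sub (z w : Fin n → ℤ) : intVec (z - w) = intVec z - intVec w := by
  ext i; simp [intVec]

theorem intVec_smul (m : ℤ) (z : Fin n → ℤ) : intVec (m • z) = (m : ℝ) • intVec z := by
  ext i; simp [intVec]

theorem intVec_injective : Function.Injective (intVec (n := n)) := by
  intro z w h
  ext i
  have := congrArg (fun x : EuclideanSpace ℝ (Fin n) => x i) h
  simpa [intVec] using this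

theorem realMat_mul (A B : Matrix (Fin n) (Fin n) ℤ) :
    realMat (A * B) = realMat A * realMat B := by
  simp [realMat, Matrix.map_mul_intCast]

theorem det_realMat (A : Matrix (Fin n) (Fin n) ℤ) : (realMat A).det = (A.det : ℝ) := by
  simp [realMat, Int.cast_det]

theorem isUnit_det_realMat {A : Matrix (Fin n) (Fin n) ℤ} (h : A.det ≠ 0) :
    IsUnit (realMat A).det := by
  rw [det_realMat, isUnit_iff_ne_zero]; exact_mod_cast h

theorem IsExpanding.det_ne_zero {A : Matrix (Fin n) (Fin n) ℤ} (h : IsExpanding A) :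
    A.det ≠ 0 := by
  intro h0
  have : (0 : ℂ) ∈ spectrum ℂ (A.map (Int.cast : ℤ → ℂ)) := by
    rw [spectrum.zero_mem_iff, Matrix.isUnit_iff_isUnit_det, ← Int.cast_det, h0]
    simp
  have := h 0 this
  simp at this
  linarith

/-- The inverse transpose of an integer matrix. -/
def dualInv (A : Matrix (Fin n) (Fin n) ℤ) :
    EuclideanSpace ℝ (Fin n) →L[ℝ] EuclideanSpace ℝ (Fin n) :=
  matMap (realMat A.transpose)⁻¹

theorem dualInv_eq (A : Matrix (Fin n) (Fin n) ℤ) :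
    dualInv A = matMap ((realMat A)⁻¹).transpose := by
  rw [dualInv, Matrix.transpose_nonsing_inv]; rfl

theorem matMap_inv_apply {A : Matrix (Fin n) (Fin n) ℤ} (h : A.det ≠ 0)
    (x : EuclideanSpace ℝ (Fin n)) : matMap (realMat A)⁻¹ (matMap (realMat A) x) = x := by
  have : matMap ((realMat A)⁻¹ * realMat A) x = x := by
    rw [Matrix.nonsing_inv_mul _ (isUnit_det_realMat h), matMap_one]; rfl
  rwa [matMap_mul] at this

theorem matMap_apply_inv {A : Matrix (Fin n) (Fin n) ℤ} (h : A.det ≠ 0)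
    (x : EuclideanSpace ℝ (Fin n)) : matMap (realMat A) (matMap (realMat A)⁻¹ x) = x := by
  have : matMap (realMat A * (realMat A)⁻¹) x = x := by
    rw [Matrix.mul_nonsing_inv _ (isUnit_det_realMat h), matMap_one]; rfl
  rwa [matMap_mul] at this

/-- The product `Rₖ₊₁ᵗ Rₖ₊₂ᵗ ⋯ Rₖ₊ₗᵗ`. -/
def dualProd (R : ℕ → Matrix (Fin n) (Fin n) ℤ) (k : ℕ) : ℕ → Matrix (Fin n) (Fin n) ℤ
  | 0 => 1
  | l + 1 => dualProd R k l * (R (k + l + 1)).transpose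

/-- The inverse of `Rₖ₊₁ᵗ Rₖ₊₂ᵗ ⋯ Rₖ₊ₗᵗ`. -/
def dualProdInv (R : ℕ → Matrix (Fin n) (Fin n) ℤ) (k l : ℕ) :
    EuclideanSpace ℝ (Fin n) →L[ℝ] EuclideanSpace ℝ (Fin n) :=
  matMap (realMat (dualProd R k l))⁻¹

theorem dualProd_eq_list_prod (R : ℕ → Matrix (Fin n) (Fin n) ℤ) (k l : ℕ) :
    ((List.range l).map fun j => (R (k + 1 + j)).transpose).prod = dualProd R k l := by
  induction l with
  | zero => rfl
  | succ l ih =>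
    rw [List.range_succ, List.map_append, List.prod_append, ih]
    simp [dualProd, add_right_comm, add_assoc]

theorem dualProd_det_ne_zero {R : ℕ → Matrix (Fin n) (Fin n) ℤ}
    (hR : ∀ k, 1 ≤ k → (R k).det ≠ 0) (k l : ℕ) : (dualProd R k l).det ≠ 0 := by
  induction l with
  | zero => simp [dualProd]
  | succ l ih =>
    rw [dualProd, Matrix.det_mul, Matrix.det_transpose]
    exact mul_ne_zero ih (hR _ (by omega))

theorem dualProdInv_zero (R : ℕ → Matrix (Fin n) (Fin n) ℤ) (k : ℕ) :
    dualProdInv R k 0 = 1 := by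
  have : realMat (1 : Matrix (Fin n) (Fin n) ℤ) = 1 := by simp [realMat]
  rw [dualProdInv, dualProd, this, inv_one, matMap_one]

theorem dualProdInv_succ (R : ℕ → Matrix (Fin n) (Fin n) ℤ) (k l : ℕ) :
    dualProdInv R k (l + 1) = dualInv (R (k + l + 1)) * dualProdInv R k l := by
  rw [dualProdInv, dualProd, realMat_mul, Matrix.mul_inv_rev, matMap_mul]; rfl

theorem dualProdInv_add (R : ℕ → Matrix (Fin n) (Fin n) ℤ) (k l m : ℕ) :
    dualProdInv R k (l + m) = dualProdInv R (k + l) m * dualProdInv R k l := by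
  induction m with
  | zero => simp [dualProdInv_zero]
  | succ m ih => rw [← add_assoc, dualProdInv_succ, dualProdInv_succ, ih, mul_assoc, add_assoc k l m]

theorem dualProdInv_shift (R : ℕ → Matrix (Fin n) (Fin n) ℤ) (k l : ℕ) :
    dualProdInv (fun j => R (k + j)) 0 l = dualProdInv R k l := by
  induction l with
  | zero => simp [dualProdInv_zero]
  | succ l ih => rw [dualProdInv_succ, dualProdInv_succ, ih, zero_add]; rfl

theorem matMap_invProd_transpose (R : ℕ → Matrix (Fin n) (Fin n) ℤ) (l : ℕ) :
    matMap (invProd R l).transpose = dualProdInv R 0 l := by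
  induction l with
  | zero => simp [dualProdInv_zero, invProd, matMap_one]
  | succ l ih =>
    rw [dualProdInv_succ, invProd, Matrix.transpose_mul, matMap_mul, ih, dualInv_eq, zero_add]

theorem invProd_det_ne_zero {R : ℕ → Matrix (Fin n) (Fin n) ℤ}
    (hR : ∀ k, 1 ≤ k → (R k).det ≠ 0) (l : ℕ) : (invProd R l).det ≠ 0 := by
  induction l with
  | zero => simp [invProd]
  | succ l ih =>
    rw [invProd, Matrix.det_mul]
    refine mul_ne_zero ih ?_
    rw [Matrix.det_nonsing_inv]
    exact (isUnit_det_realMat (hR _ (by omega))).ringInverse.ne_zero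

theorem matMap_injective {A : Matrix (Fin n) (Fin n) ℝ} (h : A.det ≠ 0) :
    Function.Injective (matMap A) := by
  intro x y hxy
  have h1 : ∀ x, matMap A⁻¹ (matMap A x) = x := fun x => by
    have : matMap (A⁻¹ * A) x = x := by
      rw [Matrix.nonsing_inv_mul _ (isUnit_iff_ne_zero.2 h), matMap_one]; rfl
    rwa [matMap_mul] at this
  rw [← h1 x, hxy, h1]

/-! ### Fourier transforms of the finite convolutions -/

/-- The Fourier transform `ξ ↦ ∫ e^{2 π i ⟨ξ, x⟩} dμ(x)`. -/
def fourierTr (μ : Measure (EuclideanSpace ℝ (Fin n))) (ξ : EuclideanSpace ℝ (Fin n)) : ℂ :=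
  charFun μ ((2 * Real.pi) • ξ)

theorem fourierTr_apply (μ : Measure (EuclideanSpace ℝ (Fin n))) (ξ : EuclideanSpace ℝ (Fin n)) :
    fourierTr μ ξ =
      ∫ x, Complex.exp (2 * (Real.pi : ℂ) * Complex.I * ((inner ℝ ξ x : ℝ) : ℂ)) ∂μ := by
  rw [fourierTr, charFun_apply]
  congr 1; ext x
  rw [inner_smul_right, real_inner_comm]
  push_cast
  congr 1; ring

/-- The partial product `∏_{j < l} m_{Dₖ₊ⱼ₊₁} ((Rₖ₊₁ᵗ ⋯ Rₖ₊ⱼ₊₁ᵗ)⁻¹ ξ)`. -/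
def maskProd (R : ℕ → Matrix (Fin n) (Fin n) ℤ) (D : ℕ → Finset (Fin n → ℤ)) (k l : ℕ)
    (ξ : EuclideanSpace ℝ (Fin n)) : ℂ :=
  ∏ j ∈ Finset.range l, mask (D (k + j + 1)) (dualProdInv R k (j + 1) ξ)

theorem maskProd_zero (R : ℕ → Matrix (Fin n) (Fin n) ℤ) (D : ℕ → Finset (Fin n → ℤ)) (k : ℕ)
    (ξ : EuclideanSpace ℝ (Fin n)) : maskProd R D k 0 ξ = 1 := by simp [maskProd]

theorem maskProd_succ (R : ℕ → Matrix (Fin n) (Fin n) ℤ) (D : ℕ → Finset (Fin n → ℤ)) (k l : ℕ)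
    (ξ : EuclideanSpace ℝ (Fin n)) : maskProd R D k (l + 1) ξ =
      maskProd R D k l ξ * mask (D (k + l + 1)) (dualProdInv R k (l + 1) ξ) :=
  Finset.prod_range_succ _ _

theorem maskProd_add (R : ℕ → Matrix (Fin n) (Fin n) ℤ) (D : ℕ → Finset (Fin n → ℤ)) (k l m : ℕ)
    (ξ : EuclideanSpace ℝ (Fin n)) : maskProd R D k (l + m) ξ =
      maskProd R D k l ξ * maskProd R D (k + l) m (dualProdInv R k l ξ) := by
  induction m with
  | zero => simp [maskProd_zero]
  | succ m ih =>
    rw [← add_assoc, maskProd_succ, maskProd_succ, ih, mul_assoc, add_assoc l m 1, dualProdInv_add,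
      ← add_assoc k l m]
    rfl

theorem maskProd_shift (R : ℕ → Matrix (Fin n) (Fin n) ℤ) (D : ℕ → Finset (Fin n → ℤ)) (k l : ℕ) :
    maskProd (fun j => R (k + j)) (fun j => D (k + j)) 0 l = maskProd R D k l := by
  ext ξ
  simp only [maskProd, dualProdInv_shift, zero_add]
  rfl

theorem continuous_mask (D : Finset (Fin n → ℤ)) : Continuous (mask D) := by
  unfold mask; fun_prop

theorem continuous_maskProd (R : ℕ → Matrix (Fin n) (Fin n) ℤ) (D : ℕ → Finset (Fin n → ℤ))
    (k l : ℕ) : Continuous (maskProd R D k l) := by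
  unfold maskProd
  refine continuous_finsetProd _ fun j _ => (continuous_mask _).comp (by fun_prop)

theorem mask_zero {D : Finset (Fin n → ℤ)} (hD : D.Nonempty) : mask D 0 = 1 := by
  have : (D.card : ℂ) ≠ 0 := by exact_mod_cast hD.card_ne_zero
  simp [mask, this]

theorem norm_exp_two_pi (t : ℝ) : ‖Complex.exp (2 * (Real.pi : ℂ) * Complex.I * (t : ℂ))‖ = 1 := by
  have : 2 * (Real.pi : ℂ) * Complex.I * (t : ℂ) = ((2 * Real.pi * t : ℝ) : ℂ) * Complex.I := by
    push_cast; ring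
  rw [this, Complex.norm_exp_ofReal_mul_I]

theorem norm_mask_le_one (D : Finset (Fin n → ℤ)) (ξ : EuclideanSpace ℝ (Fin n)) :
    ‖mask D ξ‖ ≤ 1 := by
  rw [mask, norm_mul]
  have h1 : ‖∑ d ∈ D, Complex.exp (2 * (Real.pi : ℂ) * Complex.I *
      ((inner ℝ ξ (intVec d) : ℝ) : ℂ))‖ ≤ D.card := by
    refine (norm_sum_le _ _).trans ?_
    simp [norm_exp_two_pi]
  have h2 : ‖(1 / (D.card : ℂ))‖ = 1 / (D.card : ℝ) := by simp
  rw [h2]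
  calc _ ≤ 1 / (D.card : ℝ) * D.card := by gcongr
    _ ≤ 1 := by rw [one_div]; exact inv_mul_le_one

theorem norm_one_sub_mask_le {D : Finset (Fin n → ℤ)} (hD : D.Nonempty) {B : ℝ}
    (hB : ∀ d ∈ D, ‖intVec d‖ ≤ B) (ξ : EuclideanSpace ℝ (Fin n)) :
    ‖1 - mask D ξ‖ ≤ 2 * Real.pi * B * ‖ξ‖ := by
  have hc : (D.card : ℂ) ≠ 0 := by exact_mod_cast hD.card_ne_zero
  have hc' : (D.card : ℝ) ≠ 0 := by exact_mod_cast hD.card_ne_zero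
  have h0 : 1 - mask D ξ = (1 / (D.card : ℂ)) * ∑ d ∈ D,
      (1 - Complex.exp (2 * (Real.pi : ℂ) * Complex.I * ((inner ℝ ξ (intVec d) : ℝ) : ℂ))) := by
    rw [Finset.sum_sub_distrib, mul_sub, mask]; simp [hc]
  rw [h0, norm_mul]
  have h1 : ∀ d ∈ D, ‖1 - Complex.exp (2 * (Real.pi : ℂ) * Complex.I *
      ((inner ℝ ξ (intVec d) : ℝ) : ℂ))‖ ≤ 2 * Real.pi * B * ‖ξ‖ := fun d hd => by
    rw [norm_sub_rev]
    have : 2 * (Real.pi : ℂ) * Complex.I * ((inner ℝ ξ (intVec d) : ℝ) : ℂ) =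
        Complex.I * ((2 * Real.pi * inner ℝ ξ (intVec d) : ℝ) : ℂ) := by push_cast; ring
    rw [this]
    refine Real.norm_exp_I_mul_ofReal_sub_one_le.trans ?_
    rw [Real.norm_eq_abs, abs_mul, abs_of_nonneg (by positivity : (0:ℝ) ≤ 2 * Real.pi)]
    have := (abs_real_inner_le_norm ξ (intVec d)).trans
      (mul_le_mul_of_nonneg_left (hB d hd) (norm_nonneg ξ))
    nlinarith [Real.pi_pos]
  have h2 : ‖(1 / (D.card : ℂ))‖ = 1 / (D.card : ℝ) := by simp
  rw [h2]
  calc _ ≤ 1 / (D.card : ℝ) * ∑ d ∈ D, 2 * Real.pi * B * ‖ξ‖ := by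
        gcongr; exact (norm_sum_le _ _).trans (Finset.sum_le_sum h1)
    _ = _ := by rw [Finset.sum_const, nsmul_eq_mul]; field_simp

theorem norm_maskProd_le_one (R : ℕ → Matrix (Fin n) (Fin n) ℤ) (D : ℕ → Finset (Fin n → ℤ))
    (k l : ℕ) (ξ : EuclideanSpace ℝ (Fin n)) : ‖maskProd R D k l ξ‖ ≤ 1 := by
  rw [maskProd, norm_prod]
  exact Finset.prod_le_one (fun _ _ => norm_nonneg _) fun _ _ => norm_mask_le_one _ _

theorem maskProd_apply_zero (R : ℕ → Matrix (Fin n) (Fin n) ℤ) {D : ℕ → Finset (Fin n → ℤ)}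
    (hD : ∀ k, (D k).Nonempty) (k l : ℕ) : maskProd R D k l 0 = 1 := by
  simp [maskProd, mask_zero (hD _)]

theorem fourierTr_moranFactor {R : ℕ → Matrix (Fin n) (Fin n) ℤ}
    (hR : ∀ k, 1 ≤ k → (R k).det ≠ 0) (D : ℕ → Finset (Fin n → ℤ))
    (hD : ∀ k, (D k).Nonempty) (k : ℕ) (ξ : EuclideanSpace ℝ (Fin n)) :
    fourierTr (moranFactor R D hD k : Measure (EuclideanSpace ℝ (Fin n))) ξ =
      mask (D k) (dualProdInv R 0 k ξ) := by
  classical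
  -- Injectivity keeps the number of atoms equal to the number of digits, so the measure and the
  -- mask have the same normalisation.
  have hinj : Function.Injective fun d : Fin n → ℤ => matMap (invProd R k) (intVec d) :=
    (matMap_injective (invProd_det_ne_zero hR k)).comp intVec_injective
  rw [fourierTr_apply]
  have h1 : (moranFactor R D hD k : Measure (EuclideanSpace ℝ (Fin n))) =
      ((D k).card : ℝ≥0∞)⁻¹ • ∑ d ∈ D k, Measure.dirac (matMap (invProd R k) (intVec d)) := by
    change ((((D k).image _).card : ℕ) : ℝ≥0∞)⁻¹ • ∑ a ∈ (D k).image _, Measure.dirac a = _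
    rw [Finset.card_image_of_injective _ hinj, Finset.sum_image fun x _ y _ h => hinj h]
  rw [h1, integral_smul_measure, integral_finsetSum_measure]
  · simp only [integral_dirac, mask, ← matMap_invProd_transpose]
    rw [ENNReal.toReal_inv, ENNReal.toReal_natCast, Complex.real_smul]
    push_cast
    rw [one_div]
    congr 1
    refine Finset.sum_congr rfl fun d _ => ?_
    rw [inner_matMap, Matrix.transpose_transpose]
  · intro d _
    exact integrable_dirac (by simp)

theorem fourierTr_moranPartial {R : ℕ → Matrix (Fin n) (Fin n) ℤ}
    (hR : ∀ k, 1 ≤ k → (R k).det ≠ 0) (D : ℕ → Finset (Fin n → ℤ))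
    (hD : ∀ k, (D k).Nonempty) (l : ℕ) (ξ : EuclideanSpace ℝ (Fin n)) :
    fourierTr (moranPartial R D hD l : Measure (EuclideanSpace ℝ (Fin n))) ξ =
      maskProd R D 0 l ξ := by
  induction l with
  | zero =>
    rw [maskProd_zero]
    change charFun (Measure.dirac 0) _ = 1
    simp
  | succ l ih =>
    rw [maskProd_succ, ← ih]
    change charFun (Measure.conv _ _) _ = _
    rw [charFun_conv]
    have := fourierTr_moranFactor hR D hD (l + 1) ξ
    rw [zero_add, ← this]
    rfl

end

/-! ### Convergence of the infinite mask product -/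

noncomputable section

variable {n : ℕ}

/-- Uniform contraction of the matrices from the index `K` on, and boundedness of the digits. -/
structure ContractingMoran (R : ℕ → Matrix (Fin n) (Fin n) ℤ) (D : ℕ → Finset (Fin n → ℤ))
    (r B : ℝ) (K : ℕ) : Prop where
  det_ne_zero : ∀ k, 1 ≤ k → (R k).det ≠ 0
  nonempty : ∀ k, (D k).Nonempty
  rate_nonneg : 0 ≤ r
  rate_lt_one : r < 1
  norm_dualInv_le : ∀ k, K ≤ k → ‖dualInv (R k)‖ ≤ r
  bound_nonneg : 0 ≤ B
  norm_digit_le : ∀ k, 1 ≤ k → ∀ d ∈ D k, ‖intVec d‖ ≤ B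

/-- Any rate strictly between the limsup and `1` works from some index on; transposition does not
change the Euclidean operator norm. -/
theorem MoranBounded.exists_contractingMoran {R : ℕ → Matrix (Fin n) (Fin n) ℤ}
    {D : ℕ → Finset (Fin n → ℤ)} (h : MoranBounded R D) (hR : ∀ k, 1 ≤ k → (R k).det ≠ 0)
    (hD : ∀ k, (D k).Nonempty) : ∃ r B K, ContractingMoran R D r B K := by
  obtain ⟨h1, B, hB⟩ := h
  obtain ⟨r, hr1, hr2⟩ := exists_between h1
  have he := eventually_lt_of_limsup_lt hr1
  obtain ⟨K, hK⟩ := eventually_atTop.1 he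
  have hrt : r ≠ ∞ := (hr2.trans ENNReal.one_lt_top).ne
  refine ⟨r.toReal, max B 0, K, hR, hD, ENNReal.toReal_nonneg, ?_, ?_, le_max_right _ _,
    fun k hk d hd => (hB k hk d hd).trans (le_max_left _ _)⟩
  · simpa using (ENNReal.toReal_lt_toReal hrt ENNReal.one_ne_top).2 hr2
  · intro k hk
    rw [dualInv_eq, norm_matMap_transpose, ← toReal_enorm]
    exact ENNReal.toReal_mono hrt (hK k hk).le

namespace ContractingMoran

variable {R : ℕ → Matrix (Fin n) (Fin n) ℤ} {D : ℕ → Finset (Fin n → ℤ)} {r B : ℝ} {K : ℕ}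

theorem shift (h : ContractingMoran R D r B K) (k : ℕ) :
    ContractingMoran (fun j => R (k + j)) (fun j => D (k + j)) r B K where
  det_ne_zero j hj := h.det_ne_zero _ (by omega)
  nonempty j := h.nonempty _
  rate_nonneg := h.rate_nonneg
  rate_lt_one := h.rate_lt_one
  norm_dualInv_le j hj := h.norm_dualInv_le _ (by omega)
  bound_nonneg := h.bound_nonneg
  norm_digit_le j hj := h.norm_digit_le _ (by omega)

theorem norm_dualProdInv_succ_le (h : ContractingMoran R D r B K) {k l : ℕ} (hk : K ≤ k + l + 1)
    (ξ : EuclideanSpace ℝ (Fin n)) :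
    ‖dualProdInv R k (l + 1) ξ‖ ≤ r * ‖dualProdInv R k l ξ‖ := by
  rw [dualProdInv_succ]
  exact ContinuousLinearMap.le_of_opNorm_le _ (h.norm_dualInv_le _ hk) _

theorem norm_dualProdInv_le (h : ContractingMoran R D r B K) {k : ℕ} (hk : K ≤ k) (l : ℕ)
    (ξ : EuclideanSpace ℝ (Fin n)) : ‖dualProdInv R k l ξ‖ ≤ r ^ l * ‖ξ‖ := by
  induction l with
  | zero => simp [dualProdInv_zero]
  | succ l ih =>
    refine (h.norm_dualProdInv_succ_le (by omega) ξ).trans ?_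
    rw [pow_succ', mul_assoc]
    exact mul_le_mul_of_nonneg_left ih h.rate_nonneg

theorem summable_norm_dualProdInv (h : ContractingMoran R D r B K) (k : ℕ)
    (ξ : EuclideanSpace ℝ (Fin n)) : Summable fun l => ‖dualProdInv R k l ξ‖ := by
  refine summable_of_ratio_norm_eventually_le h.rate_lt_one ?_
  filter_upwards [eventually_ge_atTop K] with l hl
  simpa using h.norm_dualProdInv_succ_le (k := k) (l := l) (by omega) ξ

/-- Consecutive partial products differ by at most `|1 - m|` at a point whose norm is summable in
`l`, and `|1 - m|` is at most linear in that norm. -/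
theorem exists_tendsto_maskProd (h : ContractingMoran R D r B K) (k : ℕ)
    (ξ : EuclideanSpace ℝ (Fin n)) :
    ∃ z, Tendsto (fun l => maskProd R D k l ξ) atTop (𝓝 z) := by
  refine cauchySeq_tendsto_of_complete (cauchySeq_of_summable_dist ?_)
  refine Summable.of_nonneg_of_le (fun _ => dist_nonneg) (fun l => ?_)
    (((summable_nat_add_iff 1).2 (h.summable_norm_dualProdInv k ξ)).mul_left (2 * Real.pi * B))
  rw [dist_eq_norm, maskProd_succ]
  have : maskProd R D k l ξ - maskProd R D k l ξ *
      mask (D (k + l + 1)) (dualProdInv R k (l + 1) ξ) =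
      maskProd R D k l ξ * (1 - mask (D (k + l + 1)) (dualProdInv R k (l + 1) ξ)) := by ring
  rw [this, norm_mul]
  have h1 := norm_maskProd_le_one R D k l ξ
  have h2 := norm_one_sub_mask_le (h.nonempty (k + l + 1)) (h.norm_digit_le (k + l + 1) (by omega))
    (dualProdInv R k (l + 1) ξ)
  exact (mul_le_of_le_one_left (norm_nonneg _) h1).trans h2

theorem norm_one_sub_maskProd_le (h : ContractingMoran R D r B K) {k : ℕ} (hk : K ≤ k) (l : ℕ)
    (ξ : EuclideanSpace ℝ (Fin n)) :
    ‖1 - maskProd R D k l ξ‖ ≤ 2 * Real.pi * B / (1 - r) * ‖ξ‖ := by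
  have hr := h.rate_lt_one
  have hr0 := h.rate_nonneg
  have hB := h.bound_nonneg
  have key : ‖1 - maskProd R D k l ξ‖ ≤
      ∑ j ∈ Finset.range l, 2 * Real.pi * B * (r ^ (j + 1) * ‖ξ‖) := by
    induction l with
    | zero => simp [maskProd_zero]
    | succ l ih =>
      rw [Finset.sum_range_succ, maskProd_succ]
      have : 1 - maskProd R D k l ξ * mask (D (k + l + 1)) (dualProdInv R k (l + 1) ξ) =
          (1 - maskProd R D k l ξ) +
          maskProd R D k l ξ * (1 - mask (D (k + l + 1)) (dualProdInv R k (l + 1) ξ)) := by ring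
      rw [this]
      refine (norm_add_le _ _).trans (add_le_add ih ?_)
      rw [norm_mul]
      have h1 := norm_maskProd_le_one R D k l ξ
      have h2 := norm_one_sub_mask_le (h.nonempty (k + l + 1))
        (h.norm_digit_le (k + l + 1) (by omega)) (dualProdInv R k (l + 1) ξ)
      refine (mul_le_of_le_one_left (norm_nonneg _) h1).trans (h2.trans ?_)
      have := h.norm_dualProdInv_le hk (l + 1) ξ
      have := Real.pi_pos
      gcongr
  refine key.trans ?_
  rw [← Finset.mul_sum, ← Finset.sum_mul, div_mul_eq_mul_div, mul_div_assoc]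
  have h3 : ∑ j ∈ Finset.range l, r ^ (j + 1) ≤ 1 / (1 - r) := by
    have h4 : ∑ j ∈ Finset.range l, r ^ (j + 1) ≤ ∑ j ∈ Finset.range l, r ^ j :=
      Finset.sum_le_sum fun j _ => pow_le_pow_of_le_one hr0 hr.le (by omega)
    have h5 := (summable_geometric_of_lt_one hr0 hr).sum_le_tsum (Finset.range l)
      (fun _ _ => by positivity)
    rw [tsum_geometric_of_lt_one hr0 hr] at h5
    rw [one_div]; exact h4.trans h5
  have := Real.pi_pos
  calc _ ≤ 2 * Real.pi * B * (1 / (1 - r) * ‖ξ‖) := by gcongr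
    _ = _ := by ring

end ContractingMoran

/-- The infinite product `∏_j m_{Dₖ₊ⱼ₊₁} ((Rₖ₊₁ᵗ ⋯ Rₖ₊ⱼ₊₁ᵗ)⁻¹ ξ)`. -/
def maskLimit (R : ℕ → Matrix (Fin n) (Fin n) ℤ) (D : ℕ → Finset (Fin n → ℤ)) (k : ℕ)
    (ξ : EuclideanSpace ℝ (Fin n)) : ℂ :=
  limUnder atTop fun l => maskProd R D k l ξ

namespace ContractingMoran

variable {R : ℕ → Matrix (Fin n) (Fin n) ℤ} {D : ℕ → Finset (Fin n → ℤ)} {r B : ℝ} {K : ℕ}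

theorem tendsto_maskProd (h : ContractingMoran R D r B K) (k : ℕ)
    (ξ : EuclideanSpace ℝ (Fin n)) :
    Tendsto (fun l => maskProd R D k l ξ) atTop (𝓝 (maskLimit R D k ξ)) :=
  tendsto_nhds_limUnder (h.exists_tendsto_maskProd k ξ)

theorem maskLimit_eq_mul (h : ContractingMoran R D r B K) (k l : ℕ)
    (ξ : EuclideanSpace ℝ (Fin n)) :
    maskLimit R D k ξ = maskProd R D k l ξ * maskLimit R D (k + l) (dualProdInv R k l ξ) := by
  have h1 := (h.tendsto_maskProd k ξ).comp (tendsto_add_atTop_nat l)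
  have h2 := (h.tendsto_maskProd (k + l) (dualProdInv R k l ξ)).const_mul (maskProd R D k l ξ)
  refine tendsto_nhds_unique h1 (h2.congr fun m => ?_)
  rw [Function.comp_apply, add_comm m l, maskProd_add]

theorem maskLimit_eq_mask_mul (h : ContractingMoran R D r B K) (k : ℕ)
    (ξ : EuclideanSpace ℝ (Fin n)) :
    maskLimit R D k ξ = mask (D (k + 1)) (dualInv (R (k + 1)) ξ) *
      maskLimit R D (k + 1) (dualInv (R (k + 1)) ξ) := by
  have h1 : dualProdInv R k 1 = dualInv (R (k + 1)) := by
    rw [dualProdInv_succ, dualProdInv_zero, mul_one, add_zero]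
  rw [h.maskLimit_eq_mul k 1, maskProd_succ, maskProd_zero, one_mul, h1, add_zero]

theorem maskLimit_zero (h : ContractingMoran R D r B K) (k : ℕ) : maskLimit R D k 0 = 1 :=
  tendsto_nhds_unique (h.tendsto_maskProd k 0)
    (by simp only [maskProd_apply_zero R h.nonempty]; exact tendsto_const_nhds)

theorem norm_one_sub_maskLimit_le (h : ContractingMoran R D r B K) {k : ℕ} (hk : K ≤ k)
    (ξ : EuclideanSpace ℝ (Fin n)) :
    ‖1 - maskLimit R D k ξ‖ ≤ 2 * Real.pi * B / (1 - r) * ‖ξ‖ :=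
  le_of_tendsto ((h.tendsto_maskProd k ξ).const_sub 1).norm
    (Eventually.of_forall fun l => h.norm_one_sub_maskProd_le hk l ξ)

theorem exists_half_le_norm_maskLimit (h : ContractingMoran R D r B K) :
    ∃ η > 0, ∀ k, K ≤ k → ∀ ξ, ‖ξ‖ < η → 1 / 2 ≤ ‖maskLimit R D k ξ‖ := by
  set C := 2 * Real.pi * B / (1 - r) with hC
  have hC0 : 0 ≤ C := div_nonneg (mul_nonneg (by positivity) h.bound_nonneg)
    (by linarith [h.rate_lt_one])
  -- The summand `1` only guards against `C = 0`.
  refine ⟨1 / (2 * (C + 1)), by positivity, fun k hk ξ hξ => ?_⟩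
  have h1 := h.norm_one_sub_maskLimit_le hk ξ
  have h2 : C * ‖ξ‖ ≤ 1 / 2 := by
    rw [lt_div_iff₀ (by positivity)] at hξ
    nlinarith [norm_nonneg ξ]
  have h3 := norm_sub_norm_le (1 : ℂ) (maskLimit R D k ξ)
  rw [norm_one] at h3
  linarith

theorem continuousAt_maskLimit (h : ContractingMoran R D r B K) (k : ℕ) :
    ContinuousAt (maskLimit R D k) 0 := by
  -- The linear estimate is available only from the index `K` on, so `K` continuous factors are
  -- split off first.
  have h1 : ContinuousAt (maskLimit R D (k + K)) 0 := by
    rw [ContinuousAt, h.maskLimit_zero, tendsto_iff_norm_sub_tendsto_zero]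
    have h2 : Tendsto (fun ξ : EuclideanSpace ℝ (Fin n) => 2 * Real.pi * B / (1 - r) * ‖ξ‖) (𝓝 0)
        (𝓝 0) := by
      have : Continuous fun ξ : EuclideanSpace ℝ (Fin n) => 2 * Real.pi * B / (1 - r) * ‖ξ‖ := by
        fun_prop
      simpa using this.tendsto 0
    refine squeeze_zero (fun _ => norm_nonneg _) (fun ξ => ?_) h2
    rw [norm_sub_rev]
    exact h.norm_one_sub_maskLimit_le (by omega) ξ
  have h3 : maskLimit R D k = fun ξ =>
      maskProd R D k K ξ * maskLimit R D (k + K) (dualProdInv R k K ξ) :=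
    funext fun ξ => h.maskLimit_eq_mul k K ξ
  rw [h3]
  refine (continuous_maskProd R D k K).continuousAt.mul ?_
  have h4 := (dualProdInv R k K).continuous.continuousAt (x := 0)
  refine ContinuousAt.comp (g := maskLimit R D (k + K)) ?_ h4
  rwa [map_zero]

/-- The rescaled argument tends to `0`, so some tail has modulus at least `1 / 2` and the zero comes
from one of finitely many factors. -/
theorem maskLimit_eq_zero (h : ContractingMoran R D r B K) {k : ℕ}
    {ξ : EuclideanSpace ℝ (Fin n)} (h0 : maskLimit R D k ξ = 0) :
    ∃ j, mask (D (k + j + 1)) (dualProdInv R k (j + 1) ξ) = 0 := by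
  obtain ⟨η, hη, hη'⟩ := h.exists_half_le_norm_maskLimit
  have h1 : ∀ᶠ l in atTop, ‖dualProdInv R k l ξ‖ < η :=
    (h.summable_norm_dualProdInv k ξ).tendsto_atTop_zero.eventually (gt_mem_nhds hη)
  obtain ⟨l, hl, hl'⟩ := (h1.and (eventually_ge_atTop K)).exists
  rw [h.maskLimit_eq_mul k l, mul_eq_zero] at h0
  rcases h0 with h0 | h0
  · rw [maskProd, Finset.prod_eq_zero_iff] at h0
    obtain ⟨j, -, hj⟩ := h0
    exact ⟨j, hj⟩
  · have := hη' (k + l) (by omega) _ hl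
    rw [h0, norm_zero] at this
    norm_num at this

theorem isMoranMeasure_iff (h : ContractingMoran R D r B K)
    {μ : ProbabilityMeasure (EuclideanSpace ℝ (Fin n))} :
    IsMoranMeasure R D h.nonempty μ ↔ fourierTr (μ : Measure _) = maskLimit R D 0 := by
  rw [IsMoranMeasure, ProbabilityMeasure.tendsto_iff_tendsto_charFun]
  have key : ∀ l ξ, charFun (moranPartial R D h.nonempty l : Measure (EuclideanSpace ℝ (Fin n)))
      ((2 * Real.pi) • ξ) = maskProd R D 0 l ξ := fun l ξ =>
    fourierTr_moranPartial h.det_ne_zero D h.nonempty l ξ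
  constructor
  · intro ht
    ext ξ
    have := ht ((2 * Real.pi) • ξ)
    simp only [key] at this
    exact tendsto_nhds_unique this (h.tendsto_maskProd 0 ξ)
  · intro he t
    have ht : t = (2 * Real.pi) • ((2 * Real.pi)⁻¹ • t) := by
      rw [smul_smul, mul_inv_cancel₀ (by positivity), one_smul]
    rw [ht]
    simp only [key]
    have := congrFun he ((2 * Real.pi)⁻¹ • t)
    rw [fourierTr] at this
    rw [this]
    exact h.tendsto_maskProd 0 _

theorem exists_isMoranMeasure (h : ContractingMoran R D r B K) :
    ∃ μ, IsMoranMeasure R D h.nonempty μ := by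
  refine exists_tendsto_of_tendsto_charFun (f := fun t => maskLimit R D 0 ((2 * Real.pi)⁻¹ • t))
    ?_ fun t => ?_
  · refine ContinuousAt.comp (g := maskLimit R D 0) ?_ (by fun_prop)
    rw [smul_zero]
    exact h.continuousAt_maskLimit 0
  · have ht : t = (2 * Real.pi) • ((2 * Real.pi)⁻¹ • t) := by
      rw [smul_smul, mul_inv_cancel₀ (by positivity), one_smul]
    refine (h.tendsto_maskProd 0 ((2 * Real.pi)⁻¹ • t)).congr fun l => ?_
    rw [← fourierTr_moranPartial h.det_ne_zero D h.nonempty, fourierTr, ← ht]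

/-- Every tail of the infinite product is the Fourier transform of a probability measure. -/
theorem exists_fourierTr_eq_maskLimit (h : ContractingMoran R D r B K) (k : ℕ) :
    ∃ μ : ProbabilityMeasure (EuclideanSpace ℝ (Fin n)),
      fourierTr (μ : Measure (EuclideanSpace ℝ (Fin n))) = maskLimit R D k := by
  obtain ⟨μ, hμ⟩ := (h.shift k).exists_isMoranMeasure
  refine ⟨μ, ((h.shift k).isMoranMeasure_iff.1 hμ).trans ?_⟩
  ext ξ
  simp only [maskLimit, maskProd_shift]

end ContractingMoran

end

/-! ### Exponentials in `L²(μ)` and the Parseval criterion for spectra -/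

noncomputable section

variable {n : ℕ}

/-- The exponential `x ↦ e^{2 π i ⟨ξ, x⟩}`. -/
def expFun (ξ x : EuclideanSpace ℝ (Fin n)) : ℂ :=
  Complex.exp (2 * (Real.pi : ℂ) * Complex.I * ((inner ℝ ξ x : ℝ) : ℂ))

theorem continuous_expFun (ξ : EuclideanSpace ℝ (Fin n)) : Continuous (expFun ξ) := by
  unfold expFun; fun_prop

theorem norm_expFun (ξ x : EuclideanSpace ℝ (Fin n)) : ‖expFun ξ x‖ = 1 := norm_exp_two_pi _

theorem conj_expFun (ξ x : EuclideanSpace ℝ (Fin n)) :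
    (starRingEnd ℂ) (expFun ξ x) = expFun (-ξ) x := by
  rw [expFun, expFun, ← Complex.exp_conj]
  congr 1
  simp only [map_mul, map_ofNat, Complex.conj_ofReal, Complex.conj_I, inner_neg_left]
  push_cast; ring

theorem expFun_mul (ξ η x : EuclideanSpace ℝ (Fin n)) :
    expFun ξ x * expFun η x = expFun (ξ + η) x := by
  rw [expFun, expFun, expFun, ← Complex.exp_add, inner_add_left]
  congr 1
  push_cast; ring

theorem memLp_expFun (μ : Measure (EuclideanSpace ℝ (Fin n))) [IsFiniteMeasure μ]
    (ξ : EuclideanSpace ℝ (Fin n)) : MemLp (expFun ξ) 2 μ :=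
  MemLp.of_bound (continuous_expFun ξ).aestronglyMeasurable 1
    (Eventually.of_forall fun x => (norm_expFun ξ x).le)

/-- The exponential `x ↦ e^{2 π i ⟨ξ, x⟩}` as an element of `L²(μ)`. -/
def expLp (μ : Measure (EuclideanSpace ℝ (Fin n))) [IsFiniteMeasure μ]
    (ξ : EuclideanSpace ℝ (Fin n)) : Lp ℂ 2 μ :=
  (memLp_expFun μ ξ).toLp

theorem inner_expLp (μ : Measure (EuclideanSpace ℝ (Fin n))) [IsFiniteMeasure μ]
    (ξ η : EuclideanSpace ℝ (Fin n)) :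
    inner ℂ (expLp μ ξ) (expLp μ η) = fourierTr μ (η - ξ) := by
  rw [L2.inner_def, fourierTr_apply]
  refine integral_congr_ae ?_
  filter_upwards [(memLp_expFun μ ξ).coeFn_toLp, (memLp_expFun μ η).coeFn_toLp] with x hx hy
  rw [expLp, expLp, hx, hy, RCLike.inner_apply, conj_expFun, expFun_mul, ← sub_eq_add_neg]
  rfl

theorem fourierTr_zero (μ : Measure (EuclideanSpace ℝ (Fin n))) [IsProbabilityMeasure μ] :
    fourierTr μ 0 = 1 := by simp [fourierTr]

theorem norm_expLp (μ : Measure (EuclideanSpace ℝ (Fin n))) [IsProbabilityMeasure μ]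
    (ξ : EuclideanSpace ℝ (Fin n)) : ‖expLp μ ξ‖ = 1 := by
  have h := norm_sq_eq_re_inner (𝕜 := ℂ) (expLp μ ξ)
  rw [inner_expLp, sub_self, fourierTr_zero, RCLike.one_re] at h
  nlinarith [norm_nonneg (expLp μ ξ)]

theorem orthonormal_expLp_neg {ι : Type*} (μ : Measure (EuclideanSpace ℝ (Fin n)))
    [IsProbabilityMeasure μ] {f : ι → EuclideanSpace ℝ (Fin n)}
    (hf : Pairwise fun i j => fourierTr μ (f i - f j) = 0) :
    Orthonormal ℂ fun i => expLp μ (-f i) := by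
  refine ⟨fun i => norm_expLp μ _, fun i j hij => ?_⟩
  change inner ℂ (expLp μ (-f i)) (expLp μ (-f j)) = 0
  rw [inner_expLp, neg_sub_neg]
  exact hf hij

/-- Nonnegative functions satisfying Bessel's inequality for the sets whose differences are
zeros of the function. -/
structure IsBessel {E : Type*} [AddGroup E] (G : E → ℝ) : Prop where
  nonneg : ∀ ξ, 0 ≤ G ξ
  sum_le_one : ∀ s : Finset E, (∀ x ∈ s, ∀ y ∈ s, x ≠ y → G (x - y) = 0) →
    ∀ ξ, ∑ x ∈ s, G (ξ + x) ≤ 1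

/-- This is Bessel's inequality for the unit vector `expLp μ ξ` against the orthonormal vectors
`expLp μ (-x)`. -/
theorem isBessel_fourierTr (μ : Measure (EuclideanSpace ℝ (Fin n))) [IsProbabilityMeasure μ] :
    IsBessel fun ξ => ‖fourierTr μ ξ‖ ^ 2 where
  nonneg ξ := by positivity
  sum_le_one s hs ξ := by
    have hv : Orthonormal ℂ fun x : s => expLp μ (-(x : EuclideanSpace ℝ (Fin n))) :=
      orthonormal_expLp_neg μ fun x y hxy => by
        simpa using hs x x.2 y y.2 fun h => hxy (Subtype.ext h)
    have := hv.sum_inner_products_le (x := expLp μ ξ) (s := Finset.univ)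
    simp only [inner_expLp, norm_expLp, sub_neg_eq_add, one_pow] at this
    rwa [Finset.sum_coe_sort s fun x => ‖fourierTr μ (ξ + x)‖ ^ 2] at this

/-- Parseval's identity for the exponentials, in terms of the Fourier transform. -/
theorem IsSpectrum.hasSum {μ : Measure (EuclideanSpace ℝ (Fin n))} [IsProbabilityMeasure μ]
    {Λ : Set (EuclideanSpace ℝ (Fin n))} (h : IsSpectrum μ Λ) (ξ : EuclideanSpace ℝ (Fin n)) :
    HasSum (fun l : Λ => ‖fourierTr μ (ξ + l)‖ ^ 2) 1 := by
  obtain ⟨-, b, hb⟩ := h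
  have hbl : ∀ l : Λ, b l = expLp μ (-(l : EuclideanSpace ℝ (Fin n))) := fun l => by
    refine Lp.ext ((hb l).trans ?_)
    refine EventuallyEq.trans (Eventually.of_forall fun x => ?_)
      (memLp_expFun μ (-(l : EuclideanSpace ℝ (Fin n)))).coeFn_toLp.symm
    simp only [expFun, inner_neg_left]
    congr 1
    push_cast; ring
  have hs := b.hasSum_inner_mul_inner (expLp μ ξ) (expLp μ ξ)
  simp only [hbl, inner_expLp, sub_self, fourierTr_zero] at hs
  have h2 : ∀ l : Λ, fourierTr μ (-(l : EuclideanSpace ℝ (Fin n)) - ξ) *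
      fourierTr μ (ξ - -(l : EuclideanSpace ℝ (Fin n))) =
      ((‖fourierTr μ (ξ + l)‖ ^ 2 : ℝ) : ℂ) := fun l => by
    have : fourierTr μ (-(l : EuclideanSpace ℝ (Fin n)) - ξ) =
        (starRingEnd ℂ) (fourierTr μ (ξ + l)) := by
      rw [fourierTr, fourierTr, ← charFun_neg, ← smul_neg]
      congr 2
      abel
    rw [this, sub_neg_eq_add, RCLike.conj_mul]
    norm_cast
  simp only [h2] at hs
  exact Complex.hasSum_ofReal.1 (by simpa using hs)

/-- The positive and negative parts of `f` are densities of two finite measures with the same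
characteristic function, so they agree almost everywhere. -/
theorem ae_eq_zero_of_integral_mul_expFun_eq_zero_of_real
    {μ : Measure (EuclideanSpace ℝ (Fin n))} [IsFiniteMeasure μ]
    {f : EuclideanSpace ℝ (Fin n) → ℝ} (hf : Integrable f μ)
    (h : ∀ ξ, ∫ x, (f x : ℂ) * expFun ξ x ∂μ = 0) : f =ᵐ[μ] 0 := by
  set μp := μ.withDensity fun x => ENNReal.ofReal (f x) with hμp
  set μm := μ.withDensity fun x => ENNReal.ofReal (-f x) with hμm
  have : IsFiniteMeasure μp := isFiniteMeasure_withDensity_ofReal hf.2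
  have : IsFiniteMeasure μm := isFiniteMeasure_withDensity_ofReal hf.neg.2
  have hint : ∀ (g : EuclideanSpace ℝ (Fin n) → ℝ), Integrable g μ → ∀ ξ,
      ∫ x, expFun ξ x ∂(μ.withDensity fun x => ENNReal.ofReal (g x)) =
        ∫ x, ((max (g x) 0 : ℝ) : ℂ) * expFun ξ x ∂μ := fun g hg ξ => by
    rw [integral_withDensity_eq_integral_toReal_smul₀ hg.1.aemeasurable.ennreal_ofReal
      (Eventually.of_forall fun _ => ENNReal.ofReal_lt_top)]
    simp [ENNReal.toReal_ofReal']
  have hi : ∀ (g : EuclideanSpace ℝ (Fin n) → ℝ), Integrable g μ → ∀ ξ,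
      Integrable (fun x => ((max (g x) 0 : ℝ) : ℂ) * expFun ξ x) μ := fun g hg ξ => by
    refine Integrable.mul_bdd (c := 1) hg.pos_part.ofReal
      (continuous_expFun ξ).aestronglyMeasurable (Eventually.of_forall fun x => ?_)
    rw [norm_expFun]
  have heq : μp = μm := by
    refine Measure.ext_of_charFun ?_
    ext t
    have ht : t = (2 * Real.pi) • ((2 * Real.pi)⁻¹ • t) := by
      rw [smul_smul, mul_inv_cancel₀ (by positivity), one_smul]
    rw [ht]
    change fourierTr μp _ = fourierTr μm _
    set ξ := (2 * Real.pi)⁻¹ • t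
    rw [fourierTr_apply, fourierTr_apply]
    change ∫ x, expFun ξ x ∂μp = ∫ x, expFun ξ x ∂μm
    rw [hμp, hμm, hint f hf ξ, hint (fun x => -f x) hf.neg ξ, ← sub_eq_zero,
      ← integral_sub (hi f hf ξ) (hi (fun x => -f x) hf.neg ξ), ← h ξ]
    congr 1; ext x
    rw [← sub_mul]
    congr 1
    norm_cast
    rcases le_total 0 (f x) with h0 | h0
    · rw [max_eq_left h0, max_eq_right (by linarith), sub_zero]
    · rw [max_eq_right h0, max_eq_left (by linarith)]; ring
  have hae := (withDensity_eq_iff hf.1.aemeasurable.ennreal_ofReal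
    hf.neg.1.aemeasurable.ennreal_ofReal hf.lintegral_lt_top.ne).1 heq
  filter_upwards [hae] with x hx
  have h1 : ENNReal.ofReal (f x) = ENNReal.ofReal (-f x) := hx
  rcases le_total 0 (f x) with h0 | h0
  · rw [ENNReal.ofReal_of_nonpos (by linarith : -f x ≤ 0), ENNReal.ofReal_eq_zero] at h1
    exact le_antisymm h1 h0
  · rw [ENNReal.ofReal_of_nonpos h0, eq_comm, ENNReal.ofReal_eq_zero] at h1
    exact le_antisymm h0 (neg_nonpos.1 h1)

/-- The exponentials are total in `L²(μ)`. -/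
theorem eq_zero_of_inner_expLp_eq_zero {μ : Measure (EuclideanSpace ℝ (Fin n))}
    [IsFiniteMeasure μ] (f : Lp ℂ 2 μ) (h : ∀ ξ, inner ℂ (expLp μ ξ) f = 0) : f = 0 := by
  have hf : Integrable f μ := (Lp.memLp f).integrable (by norm_num)
  have h1 : ∀ ξ, ∫ x, f x * expFun ξ x ∂μ = 0 := fun ξ => by
    rw [← h (-ξ), L2.inner_def]
    refine integral_congr_ae ?_
    filter_upwards [(memLp_expFun μ (-ξ)).coeFn_toLp] with x hx
    rw [expLp, hx, RCLike.inner_apply, conj_expFun, neg_neg]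
  have h2 : ∀ ξ, ∫ x, (starRingEnd ℂ) (f x) * expFun ξ x ∂μ = 0 := fun ξ => by
    -- Conjugating the relation at `-ξ` shows that the conjugate of `f` satisfies it too, so real
    -- and imaginary parts can be treated separately.
    have := congrArg (starRingEnd ℂ) (h1 (-ξ))
    rw [← integral_conj, map_zero] at this
    simpa only [map_mul, conj_expFun, neg_neg] using this
  have hi : ∀ g : EuclideanSpace ℝ (Fin n) → ℂ, Integrable g μ → ∀ ξ,
      Integrable (fun x => g x * expFun ξ x) μ := fun g hg ξ => by
    refine Integrable.mul_bdd (c := 1) hg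
      (continuous_expFun ξ).aestronglyMeasurable (Eventually.of_forall fun x => ?_)
    rw [norm_expFun]
  have hf' : Integrable (fun x => (starRingEnd ℂ) (f x)) μ :=
    hf.mono (Complex.continuous_conj.comp_aestronglyMeasurable hf.1) (by simp)
  have hre : (fun x => (f x).re) =ᵐ[μ] 0 := by
    refine ae_eq_zero_of_integral_mul_expFun_eq_zero_of_real hf.re fun ξ => ?_
    have h3 := integral_add (hi _ hf ξ) (hi _ hf' ξ)
    rw [h1, h2, add_zero] at h3
    have h4 : ∀ x, (((f x).re : ℝ) : ℂ) * expFun ξ x =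
        (1 / 2 : ℂ) * (f x * expFun ξ x + (starRingEnd ℂ) (f x) * expFun ξ x) := fun x => by
      rw [Complex.re_eq_add_conj]; ring
    simp only [h4]
    rw [integral_const_mul, h3, mul_zero]
  have him : (fun x => (f x).im) =ᵐ[μ] 0 := by
    refine ae_eq_zero_of_integral_mul_expFun_eq_zero_of_real hf.im fun ξ => ?_
    have h3 := integral_sub (hi _ hf ξ) (hi _ hf' ξ)
    rw [h1, h2, sub_zero] at h3
    have h4 : ∀ x, (((f x).im : ℝ) : ℂ) * expFun ξ x =
        (1 / (2 * Complex.I) : ℂ) *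
          (f x * expFun ξ x - (starRingEnd ℂ) (f x) * expFun ξ x) := fun x => by
      rw [Complex.im_eq_sub_conj]; ring
    simp only [h4]
    rw [integral_const_mul, h3, mul_zero]
  refine Lp.ext ?_
  filter_upwards [hre, him, Lp.coeFn_zero ℂ 2 μ] with x hx hy hz
  rw [hz]
  exact Complex.ext hx hy

/-- If Parseval's identity holds for `x`, then `x` is orthogonal to the complement of the span. -/
theorem inner_eq_zero_of_hasSum_norm_sq {ι H : Type*} [NormedAddCommGroup H]
    [InnerProductSpace ℂ H] {v : ι → H} (hv : Orthonormal ℂ v) {x f : H}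
    (hx : HasSum (fun i => ‖inner ℂ (v i) x‖ ^ 2) (‖x‖ ^ 2)) (hf : ∀ i, inner ℂ (v i) f = 0) :
    inner ℂ x f = 0 := by
  have h1 : ∀ s : Finset ι, ‖x - ∑ i ∈ s, inner ℂ (v i) x • v i‖ ^ 2 =
      ‖x‖ ^ 2 - ∑ i ∈ s, ‖inner ℂ (v i) x‖ ^ 2 := fun s => by
    have h2 : inner ℂ (∑ i ∈ s, inner ℂ (v i) x • v i) (x - ∑ i ∈ s, inner ℂ (v i) x • v i) = 0 := by
      rw [sum_inner]
      refine Finset.sum_eq_zero fun i hi => ?_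
      rw [inner_smul_left, inner_sub_right, hv.inner_right_sum _ hi, sub_self, mul_zero]
    have h3 : ‖x‖ ^ 2 = ‖∑ i ∈ s, inner ℂ (v i) x • v i‖ ^ 2 +
        ‖x - ∑ i ∈ s, inner ℂ (v i) x • v i‖ ^ 2 := by
      have := norm_add_sq_eq_norm_sq_add_norm_sq_of_inner_eq_zero _ _ h2
      rw [add_sub_cancel] at this
      simpa [sq] using this
    have h4 : ‖∑ i ∈ s, inner ℂ (v i) x • v i‖ ^ 2 = ∑ i ∈ s, ‖inner ℂ (v i) x‖ ^ 2 := by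
      have h5 := hv.inner_sum (fun i => inner ℂ (v i) x) (fun i => inner ℂ (v i) x) s
      rw [inner_self_eq_norm_sq_to_K] at h5
      simp only [RCLike.conj_mul] at h5
      exact_mod_cast h5
    rw [h3, h4]; ring
  -- Since `f` is orthogonal to every `v i`, only the residual of `x` pairs with it, and the
  -- residual tends to `0` by Parseval.
  have h6 : ∀ s : Finset ι, ‖inner ℂ x f‖ ^ 2 ≤
      (‖x‖ ^ 2 - ∑ i ∈ s, ‖inner ℂ (v i) x‖ ^ 2) * ‖f‖ ^ 2 := fun s => by
    have h7 : inner ℂ x f = inner ℂ (x - ∑ i ∈ s, inner ℂ (v i) x • v i) f := by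
      rw [inner_sub_left, sum_inner]
      simp [inner_smul_left, hf]
    rw [h7, ← h1, ← mul_pow]
    gcongr
    exact norm_inner_le_norm _ _
  have h8 : Tendsto (fun s : Finset ι => (‖x‖ ^ 2 - ∑ i ∈ s, ‖inner ℂ (v i) x‖ ^ 2) * ‖f‖ ^ 2)
      atTop (𝓝 ((‖x‖ ^ 2 - ‖x‖ ^ 2) * ‖f‖ ^ 2)) := (hx.const_sub _).mul_const _
  have h9 := ge_of_tendsto h8 (Eventually.of_forall h6)
  rw [sub_self, zero_mul] at h9
  have : ‖inner ℂ x f‖ = 0 := by nlinarith [norm_nonneg (inner ℂ x f)]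
  exact norm_eq_zero.1 this

/-- Parseval for one exponential makes it orthogonal to the complement of the span. With all
exponentials covered, totality leaves no complement. -/
theorem isSpectrum_of_hasSum {μ : Measure (EuclideanSpace ℝ (Fin n))} [IsProbabilityMeasure μ]
    {Λ : Set (EuclideanSpace ℝ (Fin n))} (hc : Λ.Countable)
    (ho : ∀ x ∈ Λ, ∀ y ∈ Λ, x ≠ y → fourierTr μ (x - y) = 0)
    (hs : ∀ ξ, HasSum (fun l : Λ => ‖fourierTr μ (ξ + l)‖ ^ 2) 1) : IsSpectrum μ Λ := by
  have hv : Orthonormal ℂ fun l : Λ => expLp μ (-(l : EuclideanSpace ℝ (Fin n))) :=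
    orthonormal_expLp_neg μ fun x y hxy => ho x x.2 y y.2 fun h => hxy (Subtype.ext h)
  have hbot : (Submodule.span ℂ (Set.range fun l : Λ =>
      expLp μ (-(l : EuclideanSpace ℝ (Fin n)))))ᗮ = ⊥ := by
    rw [Submodule.eq_bot_iff]
    intro f hf
    refine eq_zero_of_inner_expLp_eq_zero f fun ξ => ?_
    refine inner_eq_zero_of_hasSum_norm_sq hv ?_ fun l =>
      hf _ (Submodule.subset_span (Set.mem_range_self l))
    simp only [inner_expLp, norm_expLp, sub_neg_eq_add, one_pow]
    exact hs ξ
  refine ⟨hc, HilbertBasis.mkOfOrthogonalEqBot hv hbot, fun l => ?_⟩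
  rw [HilbertBasis.coe_mkOfOrthogonalEqBot]
  refine (memLp_expFun μ (-(l : EuclideanSpace ℝ (Fin n)))).coeFn_toLp.trans
    (Eventually.of_forall fun x => ?_)
  simp only [expFun, inner_neg_left]
  congr 1
  push_cast; ring

end

/-! ### Masks of three-element digit sets -/

noncomputable section

/-- The point `z / 3` for an integer vector `z`. -/
def thirdVec {n : ℕ} (z : Fin n → ℤ) : EuclideanSpace ℝ (Fin n) := (1 / 3 : ℝ) • intVec z

theorem thirdVec_add {n : ℕ} (z w : Fin n → ℤ) : thirdVec (z + w) = thirdVec z + thirdVec w := by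
  rw [thirdVec, intVec_add, smul_add]; rfl

theorem thirdVec_sub {n : ℕ} (z w : Fin n → ℤ) : thirdVec (z - w) = thirdVec z - thirdVec w := by
  rw [thirdVec, intVec_sub, smul_sub]; rfl

theorem thirdVec_three_smul {n : ℕ} (z : Fin n → ℤ) : thirdVec ((3 : ℤ) • z) = intVec z := by
  rw [thirdVec, intVec_smul, smul_smul]; norm_num

theorem thirdVec_zero {n : ℕ} : thirdVec (0 : Fin n → ℤ) = 0 := by
  ext; simp [thirdVec, intVec]

theorem thirdVec_injective {n : ℕ} : Function.Injective (thirdVec (n := n)) := fun _ _ h =>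
  intVec_injective (smul_right_injective _ (by norm_num : (1 / 3 : ℝ) ≠ 0) h)

theorem countable_range_thirdVec {n : ℕ} : (Set.range (thirdVec (n := n))).Countable :=
  Set.countable_range _

theorem matMap_realMat_thirdVec {n : ℕ} (A : Matrix (Fin n) (Fin n) ℤ) (z : Fin n → ℤ) :
    matMap (realMat A) (thirdVec z) = thirdVec (A.mulVec z) := by
  rw [thirdVec, map_smul, matMap_realMat_intVec, thirdVec]

/-- The properties of the squared modulus of the mask of a three-element digit set of determinant
`±1` whose mask vanishes at `±(1, i) / 3`. -/
structure TriMask (i : ℤ) (m : EuclideanSpace ℝ (Fin 2) → ℝ) : Prop where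
  nonneg : ∀ ξ, 0 ≤ m ξ
  add_intVec : ∀ ξ z, m (ξ + intVec z) = m ξ
  sum_eq_one : ∀ ξ, m ξ + m (ξ + thirdVec ![1, i]) + m (ξ + thirdVec ![2, 2 * i]) = 1
  of_eq_zero : ∀ ξ, m ξ = 0 → ∃ z : Fin 2 → ℤ, ξ = thirdVec z ∧ 3 ∣ z 1 - i * z 0 ∧ ¬ 3 ∣ z 0

/-- The character `t ↦ e^{2 π i t}`. -/
def unitExp (t : ℝ) : ℂ := Complex.exp (2 * (Real.pi : ℂ) * Complex.I * (t : ℂ))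

theorem unitExp_add (s t : ℝ) : unitExp (s + t) = unitExp s * unitExp t := by
  rw [unitExp, unitExp, unitExp, ← Complex.exp_add]
  congr 1; push_cast; ring

theorem unitExp_eq_one_iff (t : ℝ) : unitExp t = 1 ↔ ∃ k : ℤ, t = k := by
  rw [unitExp, Complex.exp_eq_one_iff]
  have hpi : (2 * (Real.pi : ℂ) * Complex.I) ≠ 0 := Complex.two_pi_I_ne_zero
  constructor
  · rintro ⟨k, hk⟩
    refine ⟨k, ?_⟩
    rw [mul_comm (k : ℂ)] at hk
    exact_mod_cast mul_left_cancel₀ hpi hk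
  · rintro ⟨k, rfl⟩
    exact ⟨k, by push_cast; ring⟩

theorem unitExp_intCast (k : ℤ) : unitExp k = 1 := (unitExp_eq_one_iff _).2 ⟨k, rfl⟩

theorem norm_unitExp (t : ℝ) : ‖unitExp t‖ = 1 := norm_exp_two_pi t

theorem unitExp_mul_conj (t : ℝ) : unitExp t * (starRingEnd ℂ) (unitExp t) = 1 := by
  rw [RCLike.mul_conj, norm_unitExp]; norm_num

theorem triDigits_ne {a b c d : ℤ} (h : |a * d - b * c| = 1) :
    (![0, 0] : Fin 2 → ℤ) ≠ ![a, b] ∧ (![0, 0] : Fin 2 → ℤ) ≠ ![c, d] ∧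
      (![a, b] : Fin 2 → ℤ) ≠ ![c, d] := by
  refine ⟨fun h0 => ?_, fun h0 => ?_, fun h0 => ?_⟩ <;>
  · have h1 := congrFun h0 0
    have h2 := congrFun h0 1
    simp only [Matrix.cons_val_zero, Matrix.cons_val_one] at h1 h2
    subst h1 h2
    simp [mul_comm] at h

theorem sum_triDigits {M : Type*} [AddCommMonoid M] {a b c d : ℤ} (h : |a * d - b * c| = 1)
    (f : (Fin 2 → ℤ) → M) :
    ∑ x ∈ triDigits a b c d, f x = f ![0, 0] + (f ![a, b] + f ![c, d]) := by
  obtain ⟨h1, h2, h3⟩ := triDigits_ne h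
  rw [triDigits, Finset.sum_insert (by simp [h1, h2]), Finset.sum_insert (by simpa using h3),
    Finset.sum_singleton]

theorem card_triDigits {a b c d : ℤ} (h : |a * d - b * c| = 1) :
    (triDigits a b c d).card = 3 := by
  rw [Finset.card_eq_sum_ones, sum_triDigits h]; rfl

theorem digitSum_eq_of_triDigits_eq {a b c d a' b' c' d' : ℤ} (h : |a * d - b * c| = 1)
    (he : triDigits a b c d = triDigits a' b' c' d') (i : ℤ) :
    a' + i * b' + (c' + i * d') = a + i * b + (c + i * d) := by
  have hc := card_triDigits h
  rw [he] at hc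
  have h1 : (![0, 0] : Fin 2 → ℤ) ≠ ![a', b'] := fun h0 => by
    rw [triDigits, ← h0, Finset.insert_eq_of_mem (by simp)] at hc
    have := Finset.card_le_two (a := (![0, 0] : Fin 2 → ℤ)) (b := ![c', d'])
    omega
  have h2 : (![0, 0] : Fin 2 → ℤ) ≠ ![c', d'] := fun h0 => by
    rw [triDigits, ← h0, Finset.insert_eq_of_mem (by simp)] at hc
    have := Finset.card_le_two (a := (![a', b'] : Fin 2 → ℤ)) (b := ![0, 0])
    omega
  have h3 : (![a', b'] : Fin 2 → ℤ) ≠ ![c', d'] := fun h0 => by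
    rw [triDigits, ← h0, Finset.pair_eq_singleton] at hc
    have := Finset.card_le_two (a := (![0, 0] : Fin 2 → ℤ)) (b := ![a', b'])
    omega
  have hs := sum_triDigits h fun x => x 0 + i * x 1
  rw [he, triDigits, Finset.sum_insert (by simp [h1, h2]), Finset.sum_insert (by simpa using h3),
    Finset.sum_singleton] at hs
  simpa using hs

theorem mem_Gamma1_iff {a b c d : ℤ} (h : |a * d - b * c| = 1) :
    triDigits a b c d ∈ Gamma1 ↔ 3 ∣ a + 1 * b + (c + 1 * d) := by
  constructor
  · rintro ⟨a', b', c', d', he, hm⟩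
    rw [← digitSum_eq_of_triDigits_eq h he 1]
    have := hm.dvd
    omega
  · intro h3
    refine ⟨a, b, c, d, rfl, (Int.modEq_iff_dvd).2 ?_⟩
    omega

theorem mem_Gamma2_iff {a b c d : ℤ} (h : |a * d - b * c| = 1) :
    triDigits a b c d ∈ Gamma2 ↔ 3 ∣ a + 2 * b + (c + 2 * d) := by
  constructor
  · rintro ⟨a', b', c', d', he, hm⟩
    rw [← digitSum_eq_of_triDigits_eq h he 2]
    have := hm.dvd
    omega
  · intro h3
    refine ⟨a, b, c, d, rfl, (Int.modEq_iff_dvd).2 ?_⟩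
    omega

/-- Otherwise the digit matrix would annihilate `(1, i)` modulo `3`, although its determinant is a
unit. -/
theorem not_three_dvd_of_det {a b c d i : ℤ} (h : |a * d - b * c| = 1)
    (h3 : 3 ∣ a + i * b + (c + i * d)) : ¬ 3 ∣ a + i * b := by
  rintro ⟨x, hx⟩
  obtain ⟨y, hy⟩ := h3
  have h1 : a * d - b * c = 3 * (x * d - b * (y - x)) := by
    linear_combination (d + b) * hx - b * hy
  rw [h1, abs_mul] at h
  have h2 : (3 : ℤ) ∣ 1 := ⟨_, h.symm⟩
  norm_num at h2

theorem mask_triDigits {a b c d : ℤ} (h : |a * d - b * c| = 1) (ξ : EuclideanSpace ℝ (Fin 2)) :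
    mask (triDigits a b c d) ξ =
      (1 / 3) * (1 + unitExp (ξ 0 * a + ξ 1 * b) + unitExp (ξ 0 * c + ξ 1 * d)) := by
  rw [mask, sum_triDigits h, card_triDigits h]
  have h1 : ∀ x y : ℤ, inner ℝ ξ (intVec ![x, y]) = ξ 0 * x + ξ 1 * y := fun x y => by
    simp [intVec, PiLp.inner_apply, Fin.sum_univ_two, mul_comm]
  simp only [h1, unitExp]
  simp [add_assoc]

/-- Orthogonality of the characters of `ℤ/3`: in the expansion all cross terms carry the factor `1 +
w + w ^ 2`, and each of the three squared terms contributes `3`. -/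
theorem sum_norm_sq_rotation {p q w : ℂ} (hp : p * (starRingEnd ℂ) p = 1)
    (hq : q * (starRingEnd ℂ) q = 1) (hw : (starRingEnd ℂ) w = w ^ 2) (h1 : 1 + w + w ^ 2 = 0)
    (h3 : w ^ 3 = 1) :
    ‖1 + p + q‖ ^ 2 + ‖1 + p * w + q * w ^ 2‖ ^ 2 + ‖1 + p * w ^ 2 + q * w‖ ^ 2 = 9 := by
  have h : ∀ z : ℂ, ((‖z‖ ^ 2 : ℝ) : ℂ) = z * (starRingEnd ℂ) z := fun z => by
    rw [RCLike.mul_conj]; norm_cast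
  have key : ((‖1 + p + q‖ ^ 2 + ‖1 + p * w + q * w ^ 2‖ ^ 2 + ‖1 + p * w ^ 2 + q * w‖ ^ 2 : ℝ) : ℂ)
      = 9 := by
    rw [Complex.ofReal_add, Complex.ofReal_add, h, h, h]
    simp only [map_add, map_mul, map_one, map_pow, hw]
    set P := (starRingEnd ℂ) p
    set Q := (starRingEnd ℂ) q
    have h4 : (w ^ 2) ^ 2 = w := by linear_combination w * h3
    rw [h4]
    linear_combination (p + P + q + Q + p * Q + q * P) * h1 +
      (2 * p * P + 2 * q * Q + w * (p * Q + q * P)) * h3 + 3 * hp + 3 * hq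
  exact_mod_cast key

/-- Translation by `(1, i)/3` multiplies the two nontrivial exponentials by a primitive cube root of
unity `w` and by `w ^ 2`, because `c + i d ≡ -(a + i b)` modulo `3`. At a zero of the mask the two
exponentials are the two primitive cube roots of unity; inverting the unimodular digit matrix then
locates the zero. -/
theorem triMask_triDigits {a b c d i : ℤ} (h : |a * d - b * c| = 1)
    (h3 : 3 ∣ a + i * b + (c + i * d)) :
    TriMask i fun ξ => ‖mask (triDigits a b c d) ξ‖ ^ 2 where
  nonneg ξ := by positivity
  add_intVec ξ z := by
    have h1 : ∀ x y : ℤ, unitExp ((ξ + intVec z) 0 * x + (ξ + intVec z) 1 * y) =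
        unitExp (ξ 0 * x + ξ 1 * y) := fun x y => by
      have : (ξ + intVec z) 0 * (x : ℝ) + (ξ + intVec z) 1 * y =
          (ξ 0 * x + ξ 1 * y) + ((z 0 * x + z 1 * y : ℤ) : ℝ) := by
        simp [intVec]; ring
      rw [this, unitExp_add, unitExp_intCast, mul_one]
    simp only [mask_triDigits h, h1]
  sum_eq_one ξ := by
    set w := unitExp ((a + i * b : ℤ) / 3) with hw
    have hw3 : w ^ 3 = 1 := by
      have : w ^ 3 = unitExp ((a + i * b : ℤ) : ℝ) := by
        rw [pow_succ, sq, hw, ← unitExp_add, ← unitExp_add]; congr 1; ring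
      rw [this, unitExp_intCast]
    have hw1 : w ≠ 1 := fun h1 => by
      obtain ⟨k, hk⟩ := (unitExp_eq_one_iff _).1 h1
      refine not_three_dvd_of_det h h3 ⟨k, ?_⟩
      rw [div_eq_iff (by norm_num)] at hk
      rw [mul_comm 3]; exact_mod_cast hk
    have hws : 1 + w + w ^ 2 = 0 := by
      have : (w - 1) * (1 + w + w ^ 2) = 0 := by linear_combination hw3
      exact (mul_eq_zero.1 this).resolve_left (sub_ne_zero.2 hw1)
    have hwc : (starRingEnd ℂ) w = w ^ 2 := by
      have h0 := unitExp_mul_conj ((a + i * b : ℤ) / 3)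
      rw [← hw] at h0
      have hw0 : w ≠ 0 := fun h1 => by rw [h1] at hw3; norm_num at hw3
      refine mul_left_cancel₀ hw0 ?_
      rw [h0]; linear_combination -hw3
    obtain ⟨y, hy⟩ := h3
    have hyr : (a : ℝ) + i * b + (c + i * d) = 3 * y := by exact_mod_cast hy
    set p := unitExp (ξ 0 * a + ξ 1 * b)
    set q := unitExp (ξ 0 * c + ξ 1 * d)
    have e1 : unitExp ((ξ + thirdVec ![1, i]) 0 * a + (ξ + thirdVec ![1, i]) 1 * b) = p * w := by
      rw [hw, ← unitExp_add]; congr 1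
      simp [thirdVec, intVec]; ring
    have e2 : unitExp ((ξ + thirdVec ![1, i]) 0 * c + (ξ + thirdVec ![1, i]) 1 * d) =
        q * w ^ 2 := by
      have : (ξ + thirdVec ![1, i]) 0 * c + (ξ + thirdVec ![1, i]) 1 * d =
          (ξ 0 * c + ξ 1 * d) + ((a + i * b : ℤ) / 3 + (a + i * b : ℤ) / 3) +
            ((y - (a + i * b) : ℤ) : ℝ) := by
        simp [thirdVec, intVec]; linarith
      rw [this, unitExp_add, unitExp_intCast, mul_one, unitExp_add, unitExp_add ((a + i * b : ℤ) / 3), sq]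
    have e3 : unitExp ((ξ + thirdVec ![2, 2 * i]) 0 * a + (ξ + thirdVec ![2, 2 * i]) 1 * b) =
        p * w ^ 2 := by
      rw [sq, hw, ← unitExp_add, ← unitExp_add]; congr 1
      simp [thirdVec, intVec]; ring
    have e4 : unitExp ((ξ + thirdVec ![2, 2 * i]) 0 * c + (ξ + thirdVec ![2, 2 * i]) 1 * d) =
        q * w := by
      have : (ξ + thirdVec ![2, 2 * i]) 0 * c + (ξ + thirdVec ![2, 2 * i]) 1 * d =
          (ξ 0 * c + ξ 1 * d) + (a + i * b : ℤ) / 3 +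
            ((2 * y - (a + i * b) : ℤ) : ℝ) := by
        simp [thirdVec, intVec]; linarith
      rw [this, unitExp_add, unitExp_intCast, mul_one, unitExp_add]
    have key := sum_norm_sq_rotation (unitExp_mul_conj (ξ 0 * a + ξ 1 * b))
      (unitExp_mul_conj (ξ 0 * c + ξ 1 * d)) hwc hws hw3
    simp only [mask_triDigits h, e1, e2, e3, e4, norm_mul, mul_pow]
    have h13 : ‖(1 / 3 : ℂ)‖ ^ 2 = 1 / 9 := by norm_num
    rw [h13]
    linarith
  of_eq_zero ξ hξ := by
    have hξ' : mask (triDigits a b c d) ξ = 0 := by simpa using hξ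
    rw [mask_triDigits h] at hξ'
    set s := ξ 0 * a + ξ 1 * b with hs
    set t := ξ 0 * c + ξ 1 * d with ht
    have h0 : 1 + unitExp s + unitExp t = 0 := by
      simpa using hξ'
    have h0' := congrArg (starRingEnd ℂ) h0
    simp only [map_add, map_one, map_zero] at h0'
    have hp := unitExp_mul_conj s
    have hq := unitExp_mul_conj t
    set p := unitExp s with hpdef
    set q := unitExp t with hqdef
    set P := (starRingEnd ℂ) p
    set Q := (starRingEnd ℂ) q
    -- Multiplying the conjugate relation by `p * q` gives `p * q + q + p = 0`.
    have hpq : p * q = 1 := by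
      linear_combination p * q * h0' - h0 - q * hp - p * hq
    have hp3 : p * p * p = 1 := by
      linear_combination (p * p - p) * h0 + (1 - p) * hpq
    have hp1 : p ≠ 1 := fun hp1 => by
      rw [hp1, one_mul] at hpq
      rw [hp1, hpq] at h0
      norm_num at h0
    rw [hpdef, ← unitExp_add, ← unitExp_add] at hp3
    obtain ⟨n, hn⟩ := (unitExp_eq_one_iff _).1 hp3
    rw [hpdef, hqdef, ← unitExp_add] at hpq
    obtain ⟨k, hk⟩ := (unitExp_eq_one_iff _).1 hpq
    have hn3 : ¬ 3 ∣ n := by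
      rintro ⟨l, rfl⟩
      refine hp1 ((unitExp_eq_one_iff _).2 ⟨l, ?_⟩)
      push_cast at hn; linarith
    set Δ := a * d - b * c with hΔ
    have hΔ2 : Δ * Δ = 1 := by
      rw [← abs_mul_abs_self, h]; norm_num
    have hΔ2r : (Δ : ℝ) * Δ = 1 := by exact_mod_cast hΔ2
    have hΔr : (Δ : ℝ) = a * d - b * c := by rw [hΔ]; push_cast; ring
    have hn' : 3 * s = n := by linarith
    have hm' : 3 * t = (3 * k - n : ℤ) := by push_cast; linarith
    set m : ℤ := 3 * k - n with hm
    -- Cramer's rule for `a z₀ + b z₁ = n`, `c z₀ + d z₁ = m`; the determinant `Δ` is its own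
    -- inverse.
    set z : Fin 2 → ℤ := ![Δ * (d * n - b * m), Δ * (a * m - c * n)] with hz
    have hz0 : z 0 = Δ * (d * n - b * m) := rfl
    have hz1 : z 1 = Δ * (a * m - c * n) := rfl
    have hzn : a * z 0 + b * z 1 = n := by
      rw [hz0, hz1]; linear_combination n * hΔ2 - Δ * n * hΔ
    have hd1 : 3 ∣ z 1 - i * z 0 := by
      obtain ⟨y, hy⟩ := h3
      refine ⟨Δ * (k * (a + i * b) - n * y), ?_⟩
      rw [hz0, hz1, hm]
      linear_combination (-Δ * n) * hy
    refine ⟨z, ?_, hd1, fun hd0 => hn3 ?_⟩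
    · ext j
      fin_cases j
      · simp only [thirdVec, intVec, PiLp.smul_apply, smul_eq_mul, Fin.zero_eta, hz0]
        push_cast
        rw [← hn', ← hm', hs, ht]
        linear_combination (-ξ 0) * hΔ2r + (Δ * ξ 0) * hΔr
      · simp only [thirdVec, intVec, PiLp.smul_apply, smul_eq_mul, Fin.mk_one, hz1]
        push_cast
        rw [← hn', ← hm', hs, ht]
        linear_combination (-ξ 1) * hΔ2r + (Δ * ξ 1) * hΔr
    · have : 3 ∣ z 1 := by
        have := dvd_add hd1 (hd0.mul_left i)
        simpa using this
      rw [← hzn]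
      exact dvd_add (hd0.mul_left a) (this.mul_left b)

end

/-! ### Necessity: splitting a spectrum into residue classes modulo `3` -/

noncomputable section

/-- A set whose differences are zeros of `G`, with Parseval's identity off a countable set. -/
def IsGenericSpectrum {E : Type*} [AddGroup E] (G : E → ℝ) (Λ : Set E) : Prop :=
  (∀ x ∈ Λ, ∀ y ∈ Λ, x ≠ y → G (x - y) = 0) ∧
    ∃ C : Set E, C.Countable ∧ ∀ ξ ∉ C, HasSum (Λ.indicator fun x => G (ξ + x)) 1

theorem IsBessel.summable_indicator {E : Type*} [AddGroup E] {G : E → ℝ} (hG : IsBessel G)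
    {S : Set E} (hS : ∀ x ∈ S, ∀ y ∈ S, x ≠ y → G (x - y) = 0) (ξ : E) :
    Summable (S.indicator fun x => G (ξ + x)) ∧ ∑' x, S.indicator (fun x => G (ξ + x)) x ≤ 1 := by
  classical
  have h : ∀ s : Finset E, ∑ x ∈ s, S.indicator (fun x => G (ξ + x)) x ≤ 1 := fun s => by
    have h1 : ∑ x ∈ s, S.indicator (fun x => G (ξ + x)) x = ∑ x ∈ s with x ∈ S, G (ξ + x) := by
      rw [Finset.sum_filter]; rfl
    rw [h1]
    refine hG.sum_le_one _ (fun x hx y hy => ?_) ξ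
    exact hS x (Finset.mem_filter.1 hx).2 y (Finset.mem_filter.1 hy).2
  have h0 : ∀ x, 0 ≤ S.indicator (fun x => G (ξ + x)) x := fun x =>
    Set.indicator_nonneg (fun _ _ => hG.nonneg _) _
  have hs := summable_of_sum_le h0 h
  exact ⟨hs, hs.tsum_le_of_sum_le h⟩

theorem IsGenericSpectrum.image {E : Type*} [AddCommGroup E] {G : E → ℝ} {Λ : Set E} (L : E ≃+ E)
    (h : IsGenericSpectrum (fun ξ => G (L ξ)) Λ) : IsGenericSpectrum G (L '' Λ) := by
  obtain ⟨ho, C, hC, hs⟩ := h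
  refine ⟨?_, L '' C, hC.image _, fun ξ hξ => ?_⟩
  · rintro _ ⟨x, hx, rfl⟩ _ ⟨y, hy, rfl⟩ hxy
    have := ho x hx y hy fun h => hxy (by rw [h])
    simpa only [map_sub] using this
  · have h1 := hs (L.symm ξ) fun h => hξ ⟨_, h, by simp⟩
    have h2 : (L '' Λ).indicator (fun x => G (ξ + x)) ∘ L =
        Λ.indicator fun x => G (L (L.symm ξ + x)) := by
      ext x
      by_cases hx : x ∈ Λ <;> simp [hx, Set.indicator]
    rw [← h2] at h1
    exact (Equiv.hasSum_iff L.toEquiv).1 h1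

/-- If convex combinations of the rows of `Q` add up to `1`, and every choice of one entry from
each row has sum at most `1`, then the rows are constant. -/
theorem eq_of_weighted_sum_eq_one {ι κ : Type*} [Fintype ι] [Fintype κ] {W Q : ι → κ → ℝ}
    (hW : ∀ j t, 0 < W j t) (hW1 : ∀ j, ∑ t, W j t = 1)
    (hQ : ∀ τ : ι → κ, ∑ j, Q j (τ j) ≤ 1) (hsum : ∑ j, ∑ t, W j t * Q j t = 1) :
    (∀ j t t', Q j t = Q j t') ∧ ∀ τ : ι → κ, ∑ j, Q j (τ j) = 1 := by
  have hne : ∀ _ : ι, Nonempty κ := fun j => by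
    by_contra h
    rw [not_nonempty_iff] at h
    simpa using hW1 j
  -- The choice of row maxima has sum at most `1`, yet bounds the weighted average, which is `1`.
  -- With positive weights every entry must then equal its row maximum.
  have hmax : ∀ j, ∃ t, ∀ t', Q j t' ≤ Q j t := fun j => by
    have := hne j
    exact Finite.exists_max (Q j)
  choose τ hτ using hmax
  have h1 : ∑ j, ∑ t, W j t * (Q j (τ j) - Q j t) = ∑ j, Q j (τ j) - 1 := by
    simp only [mul_sub, Finset.sum_sub_distrib, hsum, ← Finset.sum_mul, hW1, one_mul]
  have h0 : ∀ j t, 0 ≤ W j t * (Q j (τ j) - Q j t) := fun j t =>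
    mul_nonneg (hW j t).le (sub_nonneg.2 (hτ j t))
  have h2 : ∑ j, ∑ t, W j t * (Q j (τ j) - Q j t) = 0 :=
    le_antisymm (by rw [h1]; linarith [hQ τ])
      (Finset.sum_nonneg fun j _ => Finset.sum_nonneg fun t _ => h0 j t)
  have h3 : ∀ j t, Q j t = Q j (τ j) := fun j t => by
    have h4 := (Finset.sum_eq_zero_iff_of_nonneg
      (fun j _ => Finset.sum_nonneg fun t _ => h0 j t)).1 h2 j (Finset.mem_univ j)
    have h5 := (Finset.sum_eq_zero_iff_of_nonneg (fun t _ => h0 j t)).1 h4 t (Finset.mem_univ t)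
    have h6 := (mul_eq_zero.1 h5).resolve_left (hW j t).ne'
    linarith
  refine ⟨fun j t t' => by rw [h3, h3 j t'], fun σ => ?_⟩
  have h7 : ∑ j, Q j (σ j) = ∑ j, Q j (τ j) := Finset.sum_congr rfl fun j _ => h3 _ _
  rw [h7]
  linarith [h1, h2]

/-- The coset of `z` modulo `3` and the line spanned by `(1, i)`. -/
def cosetClass (i : ℤ) (z : Fin 2 → ℤ) : ZMod 3 := ((z 1 - i * z 0 : ℤ) : ZMod 3)

/-- The position of `z` modulo `3` in its coset. -/
def lineClass (z : Fin 2 → ℤ) : ZMod 3 := (z 0 : ZMod 3)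

/-- The representative of the residue class modulo `3` with the given coset and position. -/
def classRep (i : ℤ) (j t : ZMod 3) : Fin 2 → ℤ := ![(t.val : ℤ), j.val + i * t.val]

theorem TriMask.apply_add_thirdVec {i : ℤ} {m : EuclideanSpace ℝ (Fin 2) → ℝ} (hm : TriMask i m)
    (ξ : EuclideanSpace ℝ (Fin 2)) (z : Fin 2 → ℤ) :
    m (ξ + thirdVec z) = m (ξ + thirdVec (classRep i (cosetClass i z) (lineClass z))) := by
  have h0 : (3 : ℤ) ∣ z 0 - ((lineClass z).val : ℤ) := by
    rw [← Nat.cast_ofNat, ← ZMod.intCast_zmod_eq_zero_iff_dvd]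
    push_cast
    rw [ZMod.natCast_zmod_val, lineClass, sub_self]
  have h1 : (3 : ℤ) ∣ z 1 - i * z 0 - ((cosetClass i z).val : ℤ) := by
    rw [← Nat.cast_ofNat, ← ZMod.intCast_zmod_eq_zero_iff_dvd]
    push_cast
    rw [ZMod.natCast_zmod_val, cosetClass]
    push_cast; ring
  obtain ⟨x, hx⟩ := h0
  obtain ⟨y, hy⟩ := h1
  have h : z = classRep i (cosetClass i z) (lineClass z) + (3 : ℤ) • ![x, y + i * x] := by
    ext l
    fin_cases l
    · change z 0 = ((lineClass z).val : ℤ) + 3 * x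
      linarith
    · change z 1 = (((cosetClass i z).val : ℤ) + i * (lineClass z).val) + 3 * (y + i * x)
      linear_combination hy + i * hx
  conv_lhs => rw [h, thirdVec_add, thirdVec_three_smul, ← add_assoc, hm.add_intVec]

theorem TriMask.sum_classRep {i : ℤ} {m : EuclideanSpace ℝ (Fin 2) → ℝ} (hm : TriMask i m)
    (ξ : EuclideanSpace ℝ (Fin 2)) (j : ZMod 3) :
    ∑ t : ZMod 3, m (ξ + thirdVec (classRep i j t)) = 1 := by
  have h : ∑ t : ZMod 3, m (ξ + thirdVec (classRep i j t)) =
      m (ξ + thirdVec (classRep i j 0)) + m (ξ + thirdVec (classRep i j 1)) +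
        m (ξ + thirdVec (classRep i j 2)) := Fin.sum_univ_three _
  have e0 : classRep i j 0 = ![0, (j.val : ℤ)] := by simp [classRep]
  have e1 : classRep i j 1 = ![0, (j.val : ℤ)] + ![1, i] := by
    simp [classRep, ZMod.val_one]
  have e2 : classRep i j 2 = ![0, (j.val : ℤ)] + ![2, 2 * i] := by
    have : (2 : ZMod 3).val = 2 := rfl
    simp [classRep, this, mul_comm]
  rw [h, e0, e1, e2, thirdVec_add, thirdVec_add, ← add_assoc, ← add_assoc]
  exact hm.sum_eq_one _

/-- The points of `Λ` in a given residue class. -/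
def classCell (i : ℤ) (Λ : Set (EuclideanSpace ℝ (Fin 2))) (j t : ZMod 3) :
    Set (EuclideanSpace ℝ (Fin 2)) :=
  {x | x ∈ Λ ∧ ∃ z, x = thirdVec z ∧ cosetClass i z = j ∧ lineClass z = t}

/-- The points of `Λ` in the residue classes selected by `τ`. -/
def classSelect (i : ℤ) (Λ : Set (EuclideanSpace ℝ (Fin 2))) (τ : ZMod 3 → ZMod 3) :
    Set (EuclideanSpace ℝ (Fin 2)) :=
  {x | x ∈ Λ ∧ ∃ z, x = thirdVec z ∧ lineClass z = τ (cosetClass i z)}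

theorem mem_classCell_iff {i : ℤ} {Λ : Set (EuclideanSpace ℝ (Fin 2))} {j t : ZMod 3}
    {z : Fin 2 → ℤ} :
    thirdVec z ∈ classCell i Λ j t ↔ thirdVec z ∈ Λ ∧ cosetClass i z = j ∧ lineClass z = t := by
  refine and_congr_right fun _ => ⟨?_, fun h => ⟨z, rfl, h⟩⟩
  rintro ⟨w, hw, h⟩
  rwa [thirdVec_injective hw]

theorem mem_classSelect_iff {i : ℤ} {Λ : Set (EuclideanSpace ℝ (Fin 2))} {τ : ZMod 3 → ZMod 3}
    {z : Fin 2 → ℤ} : thirdVec z ∈ classSelect i Λ τ ↔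
      thirdVec z ∈ Λ ∧ lineClass z = τ (cosetClass i z) := by
  refine and_congr_right fun _ => ⟨?_, fun h => ⟨z, rfl, h⟩⟩
  rintro ⟨w, hw, h⟩
  rwa [thirdVec_injective hw]

section split

variable {i : ℤ} {m G : EuclideanSpace ℝ (Fin 2) → ℝ} {Λ : Set (EuclideanSpace ℝ (Fin 2))}

/-- A zero of `m` at `x - y` would put `x` and `y` in one coset at different positions, but a
selection has a single position per coset. So the other factor vanishes. -/
theorem TriMask.eq_zero_of_mem_classSelect (hm : TriMask i m)
    (ho : ∀ x ∈ Λ, ∀ y ∈ Λ, x ≠ y → m (x - y) * G (x - y) = 0) (τ : ZMod 3 → ZMod 3) :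
    ∀ x ∈ classSelect i Λ τ, ∀ y ∈ classSelect i Λ τ, x ≠ y → G (x - y) = 0 := by
  rintro x ⟨hx, z, rfl, hz⟩ y ⟨hy, w, rfl, hw⟩ hxy
  refine (mul_eq_zero.1 (ho _ hx _ hy hxy)).resolve_left fun h0 => ?_
  obtain ⟨v, hv, hv1, hv0⟩ := hm.of_eq_zero _ h0
  rw [← thirdVec_sub] at hv
  rw [← thirdVec_injective hv] at hv1 hv0
  have h1 : cosetClass i z = cosetClass i w := by
    rw [cosetClass, cosetClass, ZMod.intCast_eq_intCast_iff_dvd_sub]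
    obtain ⟨e, he⟩ := hv1
    simp only [Pi.sub_apply] at he
    exact ⟨-e, by push_cast; linear_combination -he⟩
  refine hv0 ?_
  have h2 : lineClass z = lineClass w := by rw [hz, hw, h1]
  rw [lineClass, lineClass, ZMod.intCast_eq_intCast_iff_dvd_sub] at h2
  obtain ⟨e, he⟩ := h2
  push_cast at he
  exact ⟨-e, by simp only [Pi.sub_apply]; linear_combination -he⟩

/-- By periodicity `m (ξ + x)` is constant on each cell, so Parseval for `m G` becomes `∑ⱼ ∑ₜ W j t
* Q j t = 1`, where `Q` holds the cell sums of `G` and each row of `W` adds up to `1`. Bessel bounds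
every selection, and `eq_of_weighted_sum_eq_one` applies. -/
theorem TriMask.exists_countable_split (hm : TriMask i m) (hG : IsBessel G)
    (h : IsGenericSpectrum (fun ξ => m ξ * G ξ) Λ) (hΛ : Λ ⊆ Set.range thirdVec) :
    ∃ C : Set (EuclideanSpace ℝ (Fin 2)), C.Countable ∧ ∀ ξ ∉ C,
      (∀ j t t', ∑' x, (classCell i Λ j t).indicator (fun x => G (ξ + x)) x =
        ∑' x, (classCell i Λ j t').indicator (fun x => G (ξ + x)) x) ∧
      ∀ τ, HasSum ((classSelect i Λ τ).indicator fun x => G (ξ + x)) 1 := by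
  classical
  obtain ⟨ho, C, hC, hs⟩ := h
  -- Zeros of `m` lie in the range of `thirdVec`; off this countable set all nine weights are
  -- strictly positive.
  refine ⟨C ∪ Set.range thirdVec, hC.union countable_range_thirdVec, fun ξ hξ => ?_⟩
  rw [Set.mem_union, not_or] at hξ
  have hcell : ∀ j t, Summable ((classCell i Λ j t).indicator fun x => G (ξ + x)) := fun j t => by
    refine (hG.summable_indicator (S := classCell i Λ j t) (fun x hx y hy => ?_) ξ).1
    refine hm.eq_zero_of_mem_classSelect ho (fun _ => t) x ?_ y ?_
    · obtain ⟨h1, z, hz, -, h2⟩ := hx; exact ⟨h1, z, hz, h2⟩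
    · obtain ⟨h1, z, hz, -, h2⟩ := hy; exact ⟨h1, z, hz, h2⟩
  set Q : ZMod 3 → ZMod 3 → ℝ := fun j t =>
    ∑' x, (classCell i Λ j t).indicator (fun x => G (ξ + x)) x with hQ
  have hselect : ∀ τ : ZMod 3 → ZMod 3,
      HasSum ((classSelect i Λ τ).indicator fun x => G (ξ + x)) (∑ j, Q j (τ j)) := fun τ => by
    have h1 := hasSum_sum (s := Finset.univ) fun (j : ZMod 3) _ => (hcell j (τ j)).hasSum
    refine h1.congr_fun fun x => ?_
    by_cases hx : x ∈ Λ
    · obtain ⟨z, rfl⟩ := hΛ hx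
      simp only [Set.indicator_apply, mem_classCell_iff, mem_classSelect_iff, hx, true_and]
      rw [Finset.sum_eq_single (cosetClass i z)]
      · simp
      · intro j _ hj; rw [if_neg fun h => hj h.1.symm]
      · simp
    · rw [Set.indicator_of_notMem fun h => hx h.1]
      exact (Finset.sum_eq_zero fun j _ => Set.indicator_of_notMem (fun h => hx h.1) _).symm
  have htotal : HasSum (Λ.indicator fun x => m (ξ + x) * G (ξ + x))
      (∑ j, ∑ t, m (ξ + thirdVec (classRep i j t)) * Q j t) := by
    have h1 := hasSum_sum (s := Finset.univ) fun (j : ZMod 3) _ =>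
      hasSum_sum (s := Finset.univ) fun (t : ZMod 3) _ =>
        (hcell j t).hasSum.mul_left (m (ξ + thirdVec (classRep i j t)))
    refine h1.congr_fun fun x => ?_
    by_cases hx : x ∈ Λ
    · obtain ⟨z, rfl⟩ := hΛ hx
      simp only [Set.indicator_apply, mem_classCell_iff, hx, true_and, if_true]
      rw [Finset.sum_eq_single (cosetClass i z), Finset.sum_eq_single (lineClass z)]
      · simp only [and_self, if_true]; rw [← hm.apply_add_thirdVec]
      · intro t _ ht; rw [if_neg fun h => ht h.2.symm, mul_zero]
      · simp
      · intro j _ hj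
        exact Finset.sum_eq_zero fun t _ => by rw [if_neg fun h => hj h.1.symm, mul_zero]
      · simp
    · rw [Set.indicator_of_notMem hx]
      refine (Finset.sum_eq_zero fun j _ => Finset.sum_eq_zero fun t _ => ?_).symm
      rw [Set.indicator_of_notMem (fun h => hx h.1), mul_zero]
  have key := eq_of_weighted_sum_eq_one (W := fun j t => m (ξ + thirdVec (classRep i j t)))
    (Q := Q) (fun j t => lt_of_le_of_ne (hm.nonneg _) fun h0 => ?_) (hm.sum_classRep ξ)
    (fun τ => ?_) (htotal.unique (hs ξ hξ.1))
  · refine ⟨key.1, fun τ => ?_⟩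
    rw [← key.2 τ]
    exact hselect τ
  · obtain ⟨z, hz, -⟩ := hm.of_eq_zero _ h0.symm
    refine hξ.2 ⟨z - classRep i j t, ?_⟩
    rw [thirdVec_sub, ← hz, add_sub_cancel_right]
  · rw [← (hselect τ).tsum_eq]
    exact (hG.summable_indicator (hm.eq_zero_of_mem_classSelect ho τ) ξ).2

theorem TriMask.isGenericSpectrum_classSelect (hm : TriMask i m) (hG : IsBessel G)
    (h : IsGenericSpectrum (fun ξ => m ξ * G ξ) Λ) (hΛ : Λ ⊆ Set.range thirdVec)
    (τ : ZMod 3 → ZMod 3) : IsGenericSpectrum G (classSelect i Λ τ) := by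
  obtain ⟨C, hC, hs⟩ := hm.exists_countable_split hG h hΛ
  exact ⟨hm.eq_zero_of_mem_classSelect h.1 τ, C, hC, fun ξ hξ => (hs ξ hξ).2 τ⟩

/-- The cell of `0` has positive sum near the origin. Cells of the same coset have equal sums, so
the cell at position `1` cannot be empty. -/
theorem TriMask.exists_mem_of_zero_mem (hm : TriMask i m) (hG : IsBessel G)
    (hG0 : G 0 = 1) (hGc : ContinuousAt G 0)
    (h : IsGenericSpectrum (fun ξ => m ξ * G ξ) Λ) (hΛ : Λ ⊆ Set.range thirdVec) (h0 : 0 ∈ Λ) :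
    ∃ z, thirdVec z ∈ Λ ∧ cosetClass i z = 0 ∧ lineClass z = 1 := by
  classical
  obtain ⟨C, hC, hs⟩ := hm.exists_countable_split hG h hΛ
  have hpos : ∀ᶠ ξ in 𝓝 (0 : EuclideanSpace ℝ (Fin 2)), 0 < G ξ :=
    hGc.eventually (lt_mem_nhds (by rw [hG0]; exact one_pos))
  obtain ⟨U, hU, hUo, hU0⟩ := eventually_nhds_iff.1 hpos
  -- A countable exceptional set leaves points arbitrarily near the origin.
  have hd : Dense Cᶜ := hC.dense_compl ℝ
  obtain ⟨ξ, hξU, hξC⟩ := hd.inter_open_nonempty U hUo ⟨0, hU0⟩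
  have h00 : (0 : EuclideanSpace ℝ (Fin 2)) ∈ classCell i Λ 0 0 := by
    rw [← thirdVec_zero] at h0 ⊢
    rw [mem_classCell_iff]
    exact ⟨h0, by simp [cosetClass], by simp [lineClass]⟩
  have hsum := (hG.summable_indicator (S := classCell i Λ 0 0) (fun x hx y hy => by
    refine hm.eq_zero_of_mem_classSelect h.1 (fun _ => 0) x ?_ y ?_
    · obtain ⟨h1, z, hz, -, h2⟩ := hx; exact ⟨h1, z, hz, h2⟩
    · obtain ⟨h1, z, hz, -, h2⟩ := hy; exact ⟨h1, z, hz, h2⟩) ξ).1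
  have h1 := hsum.le_tsum 0 fun x _ => Set.indicator_nonneg (fun _ _ => hG.nonneg _) _
  rw [Set.indicator_of_mem h00, add_zero, (hs ξ hξC).1 0 0 1] at h1
  by_contra hne
  have h2 : classCell i Λ 0 1 = ∅ := by
    refine Set.eq_empty_iff_forall_notMem.2 ?_
    rintro x ⟨hx, z, rfl, hz⟩
    exact hne ⟨z, hx, hz⟩
  rw [h2] at h1
  simp only [Set.indicator_empty, tsum_zero] at h1
  exact absurd (hU ξ hξU) (not_lt.2 h1)

end split

/-- The inverse transpose of a nonsingular integer matrix, as an additive automorphism. -/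
def dualInvEquiv {n : ℕ} (A : Matrix (Fin n) (Fin n) ℤ) (hA : A.det ≠ 0) :
    EuclideanSpace ℝ (Fin n) ≃+ EuclideanSpace ℝ (Fin n) where
  toFun := dualInv A
  invFun := matMap (realMat A.transpose)
  left_inv := matMap_apply_inv (by rwa [Matrix.det_transpose])
  right_inv := matMap_inv_apply (by rwa [Matrix.det_transpose])
  map_add' := map_add _

theorem cosetClass_mulVec_congr (i : ℤ) (A : Matrix (Fin 2) (Fin 2) ℤ) {z w y : Fin 2 → ℤ}
    (h : z = w + (3 : ℤ) • y) : cosetClass i (A.mulVec z) = cosetClass i (A.mulVec w) ∧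
      lineClass (A.mulVec z) = lineClass (A.mulVec w) := by
  have h3 : (3 : ZMod 3) = 0 := rfl
  subst h
  constructor
  · simp [cosetClass, Matrix.mulVec_add, h3]
  · simp [lineClass, Matrix.mulVec_add, h3]

/-- The inductive step of necessity. Each selection keeping the class of `0` becomes, after
rescaling, a spectrum at the next level. The freedom in the selection gives the divisibility; any
one selection continues the induction. -/
theorem exists_isGenericSpectrum_of_comp_dualInv {i₁ i₂ : ℤ}
    {m₁ m₂ G : EuclideanSpace ℝ (Fin 2) → ℝ} {A : Matrix (Fin 2) (Fin 2) ℤ} (hA : A.det ≠ 0)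
    (h₁ : TriMask i₁ m₁) (h₂ : TriMask i₂ m₂) (hG : IsBessel G) (hG0 : G 0 = 1)
    (hGc : ContinuousAt G 0)
    (hG₁ : IsBessel fun ξ => m₂ (dualInv A ξ) * G (dualInv A ξ))
    (hz : ∀ ξ, m₂ ξ * G ξ = 0 → ξ ∈ Set.range (thirdVec (n := 2)))
    {Λ : Set (EuclideanSpace ℝ (Fin 2))}
    (hΛ : IsGenericSpectrum (fun ξ => m₁ ξ * (m₂ (dualInv A ξ) * G (dualInv A ξ))) Λ)
    (h0 : 0 ∈ Λ) (hr : Λ ⊆ Set.range thirdVec) :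
    (∀ l, 3 ∣ A.transpose.mulVec ![1, i₂] l) ∧ ∃ Λ' : Set (EuclideanSpace ℝ (Fin 2)),
      IsGenericSpectrum (fun ξ => m₂ ξ * G ξ) Λ' ∧ 0 ∈ Λ' ∧ Λ' ⊆ Set.range thirdVec := by
  have hA' : A.transpose.det ≠ 0 := by rwa [Matrix.det_transpose]
  have hτ : ∀ τ : ZMod 3 → ZMod 3, τ 0 = 0 →
      IsGenericSpectrum (fun ξ => m₂ ξ * G ξ) (dualInv A '' classSelect i₁ Λ τ) ∧
      0 ∈ dualInv A '' classSelect i₁ Λ τ ∧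
      dualInv A '' classSelect i₁ Λ τ ⊆ Set.range thirdVec := fun τ hτ0 => by
    have h1 := h₁.isGenericSpectrum_classSelect hG₁ hΛ hr τ
    have h2 : (0 : EuclideanSpace ℝ (Fin 2)) ∈ classSelect i₁ Λ τ := by
      rw [← thirdVec_zero] at h0 ⊢
      rw [mem_classSelect_iff]
      exact ⟨h0, by simp [cosetClass, lineClass, hτ0]⟩
    refine ⟨IsGenericSpectrum.image (G := fun ξ => m₂ ξ * G ξ) (dualInvEquiv A hA) h1,
      ⟨0, h2, map_zero _⟩, ?_⟩
    rintro _ ⟨x, hx, rfl⟩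
    by_cases hx0 : x = 0
    · exact ⟨0, by rw [hx0, map_zero, thirdVec_zero]⟩
    · have := h1.1 x hx 0 h2 hx0
      rw [sub_zero] at this
      exact hz _ this
  refine ⟨?_, _, hτ (fun _ => 0) rfl⟩
  set s := A.transpose.mulVec ![1, i₂] with hs
  -- The rescaled selection contains some `z / 3` with `z ≡ (1, i₂)` modulo `3`. Its preimage has
  -- the residue class of `s`, which therefore is one that `τ` selects.
  have key : ∀ τ : ZMod 3 → ZMod 3, τ 0 = 0 → lineClass s = τ (cosetClass i₁ s) := fun τ hτ0 => by
    obtain ⟨hg, hg0, hgr⟩ := hτ τ hτ0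
    obtain ⟨z, ⟨x, hx, hxz⟩, hz1, hz0⟩ := h₂.exists_mem_of_zero_mem hG hG0 hGc hg hgr hg0
    have hx' : x = thirdVec (A.transpose.mulVec z) := by
      rw [← matMap_realMat_thirdVec, ← hxz]
      exact (matMap_apply_inv hA' x).symm
    rw [hx', mem_classSelect_iff] at hx
    have h1 : (3 : ℤ) ∣ z 0 - 1 := by
      rw [← Nat.cast_ofNat, ← ZMod.intCast_zmod_eq_zero_iff_dvd]
      push_cast
      rw [lineClass] at hz0
      rw [hz0, sub_self]
    have h2 : (3 : ℤ) ∣ z 1 - i₂ * z 0 := by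
      rw [← Nat.cast_ofNat, ← ZMod.intCast_zmod_eq_zero_iff_dvd]
      exact hz1
    obtain ⟨p, hp⟩ := h1
    obtain ⟨q, hq⟩ := h2
    have h3 : z = ![1, i₂] + (3 : ℤ) • ![p, q + i₂ * p] := by
      ext l
      fin_cases l
      · simp; linarith
      · simp; linear_combination hq + i₂ * hp
    obtain ⟨h4, h5⟩ := cosetClass_mulVec_congr i₁ A.transpose h3
    rw [hs, ← h4, ← h5]
    exact hx.2
  have hl : lineClass s = 0 := key (fun _ => 0) rfl
  have hc : cosetClass i₁ s = 0 := by
    by_contra hne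
    -- This selection and the zero selection disagree on every nonzero coset, so `s` lies in the
    -- zero coset.
    have := key (fun j => if j = 0 then 0 else 1) (by simp)
    simp only [if_neg hne, hl] at this
    exact absurd this (by decide)
  have hs0 : (3 : ℤ) ∣ s 0 := by
    rw [← Nat.cast_ofNat, ← ZMod.intCast_zmod_eq_zero_iff_dvd]
    exact hl
  have hs1 : (3 : ℤ) ∣ s 1 - i₁ * s 0 := by
    rw [← Nat.cast_ofNat, ← ZMod.intCast_zmod_eq_zero_iff_dvd]
    exact hc
  intro l
  fin_cases l
  · exact hs0
  · simpa using dvd_add hs1 (hs0.mul_left i₁)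

/-! ### Necessity: induction over the levels -/

section necessity

variable {R : ℕ → Matrix (Fin 2) (Fin 2) ℤ} {D : ℕ → Finset (Fin 2 → ℤ)} {r B : ℝ} {K : ℕ}

theorem ContractingMoran.norm_sq_maskLimit (h : ContractingMoran R D r B K) (k : ℕ)
    (ξ : EuclideanSpace ℝ (Fin 2)) : ‖maskLimit R D k ξ‖ ^ 2 =
      ‖mask (D (k + 1)) (dualInv (R (k + 1)) ξ)‖ ^ 2 *
        ‖maskLimit R D (k + 1) (dualInv (R (k + 1)) ξ)‖ ^ 2 := by
  rw [h.maskLimit_eq_mask_mul, norm_mul, mul_pow]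

/-- Some factor of the product vanishes, at a rescaled point of `ℤ²/3`; undoing the rescaling
applies an integer matrix, which preserves `ℤ²/3`. -/
theorem ContractingMoran.mem_range_thirdVec (h : ContractingMoran R D r B K) {i : ℕ → ℤ}
    (hT : ∀ k, 1 ≤ k → TriMask (i k) fun ξ => ‖mask (D k) ξ‖ ^ 2) {k : ℕ} (hk : 1 ≤ k)
    {ξ : EuclideanSpace ℝ (Fin 2)} (h0 : ‖mask (D k) ξ‖ ^ 2 * ‖maskLimit R D k ξ‖ ^ 2 = 0) :
    ξ ∈ Set.range (thirdVec (n := 2)) := by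
  rcases mul_eq_zero.1 h0 with h1 | h1
  · obtain ⟨z, hz, -⟩ := (hT k hk).of_eq_zero ξ h1
    exact ⟨z, hz.symm⟩
  · obtain ⟨j, hj⟩ := h.maskLimit_eq_zero (by simpa using h1)
    obtain ⟨z, hz, -⟩ := (hT (k + j + 1) (by omega)).of_eq_zero
      (dualProdInv R k (j + 1) ξ) (by simp [hj])
    refine ⟨(dualProd R k (j + 1)).mulVec z, ?_⟩
    rw [← matMap_realMat_thirdVec, ← hz]
    exact matMap_apply_inv (dualProd_det_ne_zero h.det_ne_zero k (j + 1)) ξ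

theorem ContractingMoran.isBessel_maskLimit (h : ContractingMoran R D r B K) (k : ℕ) :
    IsBessel fun ξ => ‖maskLimit R D k ξ‖ ^ 2 := by
  obtain ⟨μ, hμ⟩ := h.exists_fourierTr_eq_maskLimit k
  rw [← hμ]
  exact isBessel_fourierTr _

/-- If the infinite convolution is spectral, then `(1, iₖ) Rₖ` is divisible by `3` for `k ≥ 2`. -/
theorem ContractingMoran.three_dvd_of_isSpectrum (h : ContractingMoran R D r B K) {i : ℕ → ℤ}
    (hT : ∀ k, 1 ≤ k → TriMask (i k) fun ξ => ‖mask (D k) ξ‖ ^ 2)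
    {μ : Measure (EuclideanSpace ℝ (Fin 2))} [IsProbabilityMeasure μ]
    (hμ : fourierTr μ = maskLimit R D 0) {Λ : Set (EuclideanSpace ℝ (Fin 2))}
    (hΛ : IsSpectrum μ Λ) {k : ℕ} (hk : 2 ≤ k) (l : Fin 2) :
    3 ∣ (R k).transpose.mulVec ![1, i k] l := by
  have hstep : ∀ k, (∃ Λ : Set (EuclideanSpace ℝ (Fin 2)),
      IsGenericSpectrum (fun ξ => ‖mask (D (k + 1)) ξ‖ ^ 2 * ‖maskLimit R D (k + 1) ξ‖ ^ 2) Λ ∧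
        0 ∈ Λ ∧ Λ ⊆ Set.range thirdVec) →
      (∀ l, 3 ∣ (R (k + 1 + 1)).transpose.mulVec ![1, i (k + 1 + 1)] l) ∧
      ∃ Λ : Set (EuclideanSpace ℝ (Fin 2)), IsGenericSpectrum
        (fun ξ => ‖mask (D (k + 1 + 1)) ξ‖ ^ 2 * ‖maskLimit R D (k + 1 + 1) ξ‖ ^ 2) Λ ∧
        0 ∈ Λ ∧ Λ ⊆ Set.range thirdVec := by
    rintro k ⟨Λ, h1, h2, h3⟩
    simp only [h.norm_sq_maskLimit (k + 1)] at h1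
    refine exists_isGenericSpectrum_of_comp_dualInv (h.det_ne_zero _ (by omega))
      (hT (k + 1) (by omega)) (hT (k + 1 + 1) (by omega)) (h.isBessel_maskLimit (k + 1 + 1))
      (by simp [h.maskLimit_zero]) ((h.continuousAt_maskLimit _).norm.pow 2) ?_
      (fun ξ => h.mem_range_thirdVec hT (by omega)) h1 h2 h3
    simp only [← h.norm_sq_maskLimit (k + 1)]
    exact h.isBessel_maskLimit (k + 1)
  have hbase : ∃ Λ : Set (EuclideanSpace ℝ (Fin 2)),
      IsGenericSpectrum (fun ξ => ‖mask (D (0 + 1)) ξ‖ ^ 2 * ‖maskLimit R D (0 + 1) ξ‖ ^ 2) Λ ∧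
        0 ∈ Λ ∧ Λ ⊆ Set.range thirdVec := by
    have hsum : ∀ ξ, HasSum (Λ.indicator fun x => ‖maskLimit R D 0 (ξ + x)‖ ^ 2) 1 := fun ξ => by
      rw [← hμ]
      exact hasSum_subtype_iff_indicator.1 (hΛ.hasSum ξ)
    have horth : ∀ x ∈ Λ, ∀ y ∈ Λ, x ≠ y → ‖maskLimit R D 0 (x - y)‖ ^ 2 = 0 := by
      classical
      intro x hx y hy hxy
      -- At `-y` the term of `y` already uses up the total mass `1`.
      have h1 := sum_le_hasSum {x, y} (fun z _ => Set.indicator_nonneg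
        (fun _ _ => by positivity) z) (hsum (-y))
      rw [Finset.sum_pair hxy, Set.indicator_of_mem hx, Set.indicator_of_mem hy, neg_add_cancel,
        h.maskLimit_zero, norm_one, neg_add_eq_sub] at h1
      exact le_antisymm (by linarith) (by positivity)
    obtain ⟨x₀, hx₀⟩ : Λ.Nonempty := by
      rw [Set.nonempty_iff_ne_empty]
      rintro rfl
      have h1 := hsum 0
      simp only [Set.indicator_empty] at h1
      have := h1.unique hasSum_zero
      norm_num at this
    have hgen : IsGenericSpectrum (fun ξ => ‖maskLimit R D 0 ξ‖ ^ 2) ((fun x => x - x₀) '' Λ) := by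
      refine ⟨?_, ∅, Set.countable_empty, fun ξ _ => ?_⟩
      · rintro _ ⟨x, hx, rfl⟩ _ ⟨y, hy, rfl⟩ hxy
        simp only [sub_sub_sub_cancel_right]
        exact horth x hx y hy fun h => hxy (by rw [h])
      · have h1 := hsum (ξ - x₀)
        have h2 : ((fun x => x - x₀) '' Λ).indicator (fun x => ‖maskLimit R D 0 (ξ + x)‖ ^ 2) ∘
            (Equiv.subRight x₀) = Λ.indicator fun x => ‖maskLimit R D 0 (ξ - x₀ + x)‖ ^ 2 := by
          ext x
          have h3 : ξ + (x - x₀) = ξ - x₀ + x := by abel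
          by_cases hx : x ∈ Λ <;> simp [hx, Set.indicator, h3]
        rw [← h2] at h1
        exact (Equiv.hasSum_iff _).1 h1
    simp only [h.norm_sq_maskLimit 0] at hgen
    have himg := IsGenericSpectrum.image (G := fun ξ => ‖mask (D (0 + 1)) ξ‖ ^ 2 *
      ‖maskLimit R D (0 + 1) ξ‖ ^ 2) (dualInvEquiv (R (0 + 1)) (h.det_ne_zero _ le_rfl)) hgen
    have hz0 : (0 : EuclideanSpace ℝ (Fin 2)) ∈
        dualInvEquiv (R (0 + 1)) (h.det_ne_zero _ le_rfl) '' ((fun x => x - x₀) '' Λ) :=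
      ⟨0, ⟨x₀, hx₀, sub_self _⟩, map_zero _⟩
    refine ⟨_, himg, hz0, fun x hx => ?_⟩
    by_cases hx0 : x = 0
    · exact ⟨0, by rw [hx0, thirdVec_zero]⟩
    · have := himg.1 x hx 0 hz0 hx0
      rw [sub_zero] at this
      exact h.mem_range_thirdVec hT le_rfl this
  have hall : ∀ k, ∃ Λ : Set (EuclideanSpace ℝ (Fin 2)),
      IsGenericSpectrum (fun ξ => ‖mask (D (k + 1)) ξ‖ ^ 2 * ‖maskLimit R D (k + 1) ξ‖ ^ 2) Λ ∧
        0 ∈ Λ ∧ Λ ⊆ Set.range thirdVec := fun k => by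
    induction k with
    | zero => exact hbase
    | succ k ih => exact (hstep k ih).2
  obtain ⟨j, rfl⟩ := Nat.exists_eq_add_of_le' hk
  exact (hstep j (hall j)).1 l

end necessity

end

/-! ### Sufficiency: lower bounds for masks -/

noncomputable section

theorem mask_add_intVec {n : ℕ} (D : Finset (Fin n → ℤ)) (ξ : EuclideanSpace ℝ (Fin n))
    (z : Fin n → ℤ) : mask D (ξ + intVec z) = mask D ξ := by
  rw [mask, mask]
  congr 1
  refine Finset.sum_congr rfl fun d _ => ?_
  have h : inner ℝ (intVec z) (intVec d) = ((∑ j, z j * d j : ℤ) : ℝ) := by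
    simp [intVec, PiLp.inner_apply, mul_comm]
  rw [inner_add_left, h]
  change unitExp _ = unitExp _
  rw [unitExp_add, unitExp_intCast, mul_one]

theorem abs_apply_le_norm {n : ℕ} (x : EuclideanSpace ℝ (Fin n)) (j : Fin n) : |x j| ≤ ‖x‖ := by
  simpa using PiLp.norm_apply_le x j

theorem norm_le_of_abs_apply_le {x : EuclideanSpace ℝ (Fin 2)} {b : ℝ}
    (h : ∀ j, |x j| ≤ b) : ‖x‖ ≤ 2 * b := by
  have hb : 0 ≤ b := (abs_nonneg _).trans (h 0)
  rw [EuclideanSpace.norm_eq]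
  refine Real.sqrt_le_iff.2 ⟨by linarith, ?_⟩
  simp only [Fin.sum_univ_two, Real.norm_eq_abs]
  have h0 := pow_le_pow_left₀ (abs_nonneg _) (h 0) 2
  have h1 := pow_le_pow_left₀ (abs_nonneg _) (h 1) 2
  nlinarith

/-- The mask and its zero set are `ℤ²`-periodic, so a minimum over a compact set suffices. -/
theorem exists_forall_le_norm_mask (D : Finset (Fin 2 → ℤ)) {β : ℝ} (hβ : 0 < β) :
    ∃ γ > 0, ∀ y ∉ Metric.thickening β (maskZeros D), γ ≤ ‖mask D y‖ := by
  set C := Metric.closedBall (0 : EuclideanSpace ℝ (Fin 2)) 1 ∩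
    (Metric.thickening β (maskZeros D))ᶜ with hC
  have hCc : IsCompact C := (isCompact_closedBall _ _).inter_right
    Metric.isOpen_thickening.isClosed_compl
  have hred : ∀ y ∉ Metric.thickening β (maskZeros D), ∃ y' ∈ C, mask D y' = mask D y := by
    intro y hy
    set z : Fin 2 → ℤ := fun j => round (y j) with hz
    have hy' : y = (y - intVec z) + intVec z := by abel
    refine ⟨y - intVec z, ⟨?_, fun hm => hy ?_⟩, ?_⟩
    · rw [mem_closedBall_zero_iff]
      have := norm_le_of_abs_apply_le (x := y - intVec z) (b := 1 / 2) fun j => by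
        simpa [intVec, hz] using abs_sub_round (y j)
      linarith
    · obtain ⟨w, hw, hd⟩ := Metric.mem_thickening_iff.1 hm
      refine Metric.mem_thickening_iff.2 ⟨w + intVec z, ?_, ?_⟩
      · rw [maskZeros, Set.mem_ofPred_eq, mask_add_intVec]; exact hw
      · rw [hy', dist_add_right]; exact hd
    · conv_rhs => rw [hy', mask_add_intVec]
  rcases C.eq_empty_or_nonempty with h0 | h0
  · refine ⟨1, one_pos, fun y hy => ?_⟩
    obtain ⟨y', hy', -⟩ := hred y hy
    rw [h0] at hy'
    exact hy'.elim
  · obtain ⟨x, hx, hmin⟩ := hCc.exists_isMinOn h0 (continuous_mask D).norm.continuousOn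
    refine ⟨‖mask D x‖, norm_pos_iff.2 fun h1 => hx.2 ?_, fun y hy => ?_⟩
    · exact Metric.self_subset_thickening hβ _ h1
    · obtain ⟨y', hy', he⟩ := hred y hy
      rw [← he]
      exact hmin hy'

theorem exists_uniform_le_norm_mask {B β : ℝ} (hβ : 0 < β) :
    ∃ γ > 0, ∀ D : Finset (Fin 2 → ℤ), (∀ d ∈ D, ‖intVec d‖ ≤ B) →
      ∀ y ∉ Metric.thickening β (maskZeros D), γ ≤ ‖mask D y‖ := by
  classical
  choose γ hγ hγ' using fun D => exists_forall_le_norm_mask D hβ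
  -- Bounded integer digits leave finitely many digit sets, hence a smallest constant.
  set s : Finset (Fin 2 → ℤ) := Finset.Icc (fun _ => -⌈B⌉) (fun _ => ⌈B⌉)
  obtain ⟨D₀, -, hmin⟩ := Finset.exists_min_image s.powerset γ ⟨∅, Finset.empty_mem_powerset _⟩
  refine ⟨γ D₀, hγ D₀, fun D hD y hy => (hmin D ?_).trans (hγ' D y hy)⟩
  rw [Finset.mem_powerset]
  intro d hd
  have h1 : ∀ j, |d j| ≤ ⌈B⌉ := fun j => by
    have h2 := (abs_apply_le_norm (intVec d) j).trans ((hD d hd).trans (Int.le_ceil B))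
    have h3 : (intVec d) j = (d j : ℝ) := rfl
    rw [h3, ← Int.cast_abs] at h2
    exact Int.cast_le.1 h2
  rw [Finset.mem_Icc]
  exact ⟨fun j => (abs_le.1 (h1 j)).1, fun j => (abs_le.1 (h1 j)).2⟩

section sufficiency

variable {R : ℕ → Matrix (Fin 2) (Fin 2) ℤ} {D : ℕ → Finset (Fin 2 → ℤ)} {r B : ℝ} {K : ℕ}

/-- After a fixed number `P` of contractions the cube is so small that the tail is at least `1 / 2`.
Separation keeps each of the first `P` factors at least `γ`, with `γ` independent of `k`. -/
theorem ContractingMoran.exists_le_norm_maskLimit (h : ContractingMoran R D r B K) {δ β : ℝ}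
    (hδ : δ < 1 / 4) (hβ : 0 < β) {N : ℕ}
    (hadm : ∀ k, N < k → ∀ p, 1 ≤ p → dualProd R k p ∈ admissibleMatrices D δ β) :
    ∃ c > 0, ∃ k₀, ∀ k, k₀ ≤ k → ∀ x ∈ cube 2 δ, c ≤ ‖maskLimit R D k x‖ := by
  obtain ⟨γ, hγ, hγ'⟩ := exists_uniform_le_norm_mask (B := B) hβ
  obtain ⟨η, hη, hη'⟩ := h.exists_half_le_norm_maskLimit
  obtain ⟨P, hP⟩ := exists_pow_lt_of_lt_one (half_pos hη) h.rate_lt_one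
  refine ⟨γ ^ P * (1 / 2), by positivity, max K (N + 1), fun k hk x hx => ?_⟩
  have hkK : K ≤ k := (le_max_left _ _).trans hk
  have hkN : N < k := (le_max_right K (N + 1)).trans hk
  have hxn : ‖x‖ ≤ 2 := by
    have := norm_le_of_abs_apply_le (x := x) (b := 1) fun j => by
      have := hx j
      rw [Set.mem_Icc] at this
      rw [abs_le]
      constructor <;> linarith
    linarith
  rw [h.maskLimit_eq_mul k P, norm_mul]
  refine mul_le_mul ?_ (hη' _ (by omega) _ ?_) (by norm_num) (norm_nonneg _)
  · rw [maskProd, norm_prod]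
    calc γ ^ P = ∏ _j ∈ Finset.range P, γ := by simp
      _ ≤ _ := Finset.prod_le_prod (fun _ _ => hγ.le) fun j _ => ?_
    refine hγ' _ (h.norm_digit_le _ (by omega)) _ fun hm => ?_
    have h1 := (hadm k hkN (j + 1) (by omega)).2
    have h2 : dualProdInv R k (j + 1) x ∈ (∅ : Set (EuclideanSpace ℝ (Fin 2))) := by
      rw [← h1]
      refine ⟨⟨x, hx, rfl⟩, Metric.thickening_subset_of_subset β ?_ hm⟩
      exact Set.subset_biUnion_of_mem (u := fun k => maskZeros (D k))
        (show 1 ≤ k + j + 1 by omega)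
    exact h2
  · have h1 := h.norm_dualProdInv_le hkK P x
    have h2 : r ^ P * ‖x‖ ≤ r ^ P * 2 := by
      have := pow_nonneg h.rate_nonneg P
      gcongr
    linarith

/-! ### Sufficiency: spectra of the finite convolutions -/

theorem maskProd_add_intVec (hR : ∀ k, 1 ≤ k → (R k).det ≠ 0) (l : ℕ)
    (ξ : EuclideanSpace ℝ (Fin 2)) (z : Fin 2 → ℤ) :
    maskProd R D 0 l (ξ + matMap (realMat (dualProd R 0 l)) (intVec z)) = maskProd R D 0 l ξ := by
  induction l generalizing z with
  | zero => simp [maskProd_zero]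
  | succ l ih =>
    rw [maskProd_succ, maskProd_succ]
    congr 1
    · rw [matMap_realMat_intVec, dualProd, ← Matrix.mulVec_mulVec, ← matMap_realMat_intVec]
      exact ih _
    · rw [map_add]
      have : dualProdInv R 0 (l + 1) (matMap (realMat (dualProd R 0 (l + 1))) (intVec z)) =
          intVec z := matMap_inv_apply (dualProd_det_ne_zero hR 0 (l + 1)) _
      rw [this, mask_add_intVec]

/-- `S` is a spectrum of the `l`-th finite convolution, by Parseval's identity. -/
def IsFiniteSpectrum (R : ℕ → Matrix (Fin 2) (Fin 2) ℤ) (D : ℕ → Finset (Fin 2 → ℤ)) (l : ℕ)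
    (S : Finset (EuclideanSpace ℝ (Fin 2))) : Prop :=
  ∀ ξ, ∑ x ∈ S, ‖maskProd R D 0 l (ξ + x)‖ ^ 2 = 1

theorem IsFiniteSpectrum.eq_zero {l : ℕ} {S : Finset (EuclideanSpace ℝ (Fin 2))}
    (hS : IsFiniteSpectrum R D l S) (hD : ∀ k, (D k).Nonempty) {x y : EuclideanSpace ℝ (Fin 2)}
    (hx : x ∈ S) (hy : y ∈ S) (hxy : x ≠ y) : maskProd R D 0 l (x - y) = 0 := by
  classical
  have h1 := Finset.sum_le_sum_of_subset_of_nonneg (s := {x, y}) (t := S)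
    (f := fun w => ‖maskProd R D 0 l (-y + w)‖ ^ 2) (by
      intro w hw
      rcases Finset.mem_insert.1 hw with rfl | hw
      · exact hx
      · rwa [Finset.mem_singleton.1 hw]) (fun _ _ _ => by positivity)
  rw [hS (-y), Finset.sum_pair hxy, neg_add_cancel, maskProd_apply_zero R hD, norm_one,
    neg_add_eq_sub] at h1
  have h2 : ‖maskProd R D 0 l (x - y)‖ ^ 2 = 0 := le_antisymm (by linarith) (by positivity)
  simpa using h2

/-- Moving points by periods changes no summand. Two points cannot collide: their difference would
be a period, where the product is `1` and not `0`. -/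
theorem IsFiniteSpectrum.image {l : ℕ} {S : Finset (EuclideanSpace ℝ (Fin 2))}
    [DecidableEq (EuclideanSpace ℝ (Fin 2))]
    (hS : IsFiniteSpectrum R D l S) (hD : ∀ k, (D k).Nonempty)
    (hR : ∀ k, 1 ≤ k → (R k).det ≠ 0)
    {g : EuclideanSpace ℝ (Fin 2) → EuclideanSpace ℝ (Fin 2)}
    (hg : ∀ x, ∃ z, g x = x + matMap (realMat (dualProd R 0 l)) (intVec z)) :
    IsFiniteSpectrum R D l (S.image g) := by
  choose z hz using hg
  intro ξ
  rw [Finset.sum_image]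
  · simp only [hz, ← add_assoc, maskProd_add_intVec hR]
    exact hS ξ
  · intro x hx y hy hxy
    by_contra hne
    have h1 := hS.eq_zero hD hx hy hne
    rw [hz, hz] at hxy
    have h2 : x - y = 0 + matMap (realMat (dualProd R 0 l)) (intVec (z y - z x)) := by
      rw [intVec_sub, map_sub, zero_add, sub_eq_sub_iff_add_eq_add, hxy, add_comm]
    rw [h2, maskProd_add_intVec hR, maskProd_apply_zero R hD] at h1
    exact one_ne_zero h1

theorem TriMask.sum_range_three {i : ℤ} {m : EuclideanSpace ℝ (Fin 2) → ℝ} (hm : TriMask i m)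
    (ξ : EuclideanSpace ℝ (Fin 2)) :
    ∑ n ∈ Finset.range 3, m (ξ + thirdVec ((n : ℤ) • ![1, i])) = 1 := by
  simp only [Finset.sum_range_succ, Finset.sum_range_zero, zero_add]
  have h0 : ((0 : ℕ) : ℤ) • (![1, i] : Fin 2 → ℤ) = 0 := by simp
  have h1 : ((1 : ℕ) : ℤ) • (![1, i] : Fin 2 → ℤ) = ![1, i] := by simp
  have h2 : ((2 : ℕ) : ℤ) • (![1, i] : Fin 2 → ℤ) = ![2, 2 * i] := by simp
  rw [h0, h1, h2, thirdVec_zero, add_zero]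
  exact hm.sum_eq_one ξ

/-- Each point is replaced by three translates. The first `l` factors do not see the translation, by
`hper`, and the squared new factor adds up to `1` over the three. -/
theorem IsFiniteSpectrum.exists_succ {l : ℕ} {S : Finset (EuclideanSpace ℝ (Fin 2))} {i : ℤ}
    (hS : IsFiniteSpectrum R D l S) (hD : ∀ k, (D k).Nonempty)
    (hR : ∀ k, 1 ≤ k → (R k).det ≠ 0)
    (hT : TriMask i fun ξ => ‖mask (D (l + 1)) ξ‖ ^ 2)
    (hper : ∀ ξ (n : ℤ), maskProd R D 0 l
      (ξ + matMap (realMat (dualProd R 0 (l + 1))) (thirdVec (n • ![1, i]))) =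
        maskProd R D 0 l ξ) :
    ∃ S', S ⊆ S' ∧ IsFiniteSpectrum R D (l + 1) S' := by
  classical
  set A := matMap (realMat (dualProd R 0 (l + 1))) with hA
  have hdet := dualProd_det_ne_zero hR 0 (l + 1)
  refine ⟨(S ×ˢ Finset.range 3).image fun p => p.1 + A (thirdVec ((p.2 : ℤ) • ![1, i])), ?_, ?_⟩
  · intro x hx
    exact Finset.mem_image.2 ⟨(x, 0), by simp [hx], by simp [thirdVec_zero]⟩
  · intro ξ
    rw [Finset.sum_image, Finset.sum_product]
    · have h1 : ∀ x ∈ S, ∑ n ∈ Finset.range 3,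
          ‖maskProd R D 0 (l + 1) (ξ + (x + A (thirdVec ((n : ℤ) • ![1, i]))))‖ ^ 2 =
          ‖maskProd R D 0 l (ξ + x)‖ ^ 2 := fun x _ => by
        rw [← mul_one (‖maskProd R D 0 l (ξ + x)‖ ^ 2),
          ← hT.sum_range_three (dualProdInv R 0 (l + 1) (ξ + x)), Finset.mul_sum]
        refine Finset.sum_congr rfl fun n _ => ?_
        rw [← add_assoc, maskProd_succ, hper, norm_mul, mul_pow, map_add]
        have h2 : dualProdInv R 0 (l + 1) (A (thirdVec ((n : ℤ) • ![1, i]))) =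
            thirdVec ((n : ℤ) • ![1, i]) := matMap_inv_apply hdet _
        rw [h2, zero_add]
      rw [Finset.sum_congr rfl h1]
      exact hS ξ
    · rintro ⟨x, n⟩ hx ⟨y, p⟩ hy hxy
      simp only [Finset.coe_product, Set.mem_prod, Finset.mem_coe] at hx hy hxy
      have hxy' : x = y := by
        by_contra hne
        have h1 := hS.eq_zero hD hx.1 hy.1 hne
        have h2 : x - y = 0 + A (thirdVec (((p : ℤ) - n) • ![1, i])) := by
          rw [sub_smul, thirdVec_sub, map_sub, zero_add, sub_eq_sub_iff_add_eq_add, hxy, add_comm]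
        rw [h2, hper, maskProd_apply_zero R hD] at h1
        exact one_ne_zero h1
      subst hxy'
      have h3 := add_left_cancel hxy
      have h4 : Function.Injective A := fun u v huv => by
        rw [← matMap_inv_apply hdet u, ← matMap_inv_apply hdet v]
        exact congrArg _ huv
      have h5 := congrFun (thirdVec_injective (h4 h3)) 0
      simp at h5
      rw [h5]

variable {i : ℕ → ℤ}

theorem maskProd_add_dualProd_thirdVec (hR : ∀ k, 1 ≤ k → (R k).det ≠ 0)
    (hdiv : ∀ k, 2 ≤ k → ∀ j, 3 ∣ (R k).transpose.mulVec ![1, i k] j) (l : ℕ)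
    (ξ : EuclideanSpace ℝ (Fin 2)) (n : ℤ) : maskProd R D 0 l
      (ξ + matMap (realMat (dualProd R 0 (l + 1))) (thirdVec (n • ![1, i (l + 1)]))) =
        maskProd R D 0 l ξ := by
  -- For `l = 0` the product is empty, which is why no condition on `R 1` is needed.
  rcases Nat.eq_zero_or_pos l with rfl | hl
  · rw [maskProd_zero, maskProd_zero]
  · choose w hw using hdiv (l + 1) (by omega)
    have h1 : (R (0 + l + 1)).transpose.mulVec (n • ![1, i (l + 1)]) = (3 : ℤ) • (n • w) := by
      rw [zero_add, Matrix.mulVec_smul]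
      ext j
      simp only [Pi.smul_apply, smul_eq_mul, hw]
      ring
    rw [matMap_realMat_thirdVec, dualProd, ← Matrix.mulVec_mulVec, h1, ← matMap_realMat_thirdVec,
      thirdVec_three_smul, maskProd_add_intVec hR]

theorem IsFiniteSpectrum.exists_add {l : ℕ} {S : Finset (EuclideanSpace ℝ (Fin 2))}
    (hS : IsFiniteSpectrum R D l S) (hD : ∀ k, (D k).Nonempty)
    (hR : ∀ k, 1 ≤ k → (R k).det ≠ 0)
    (hT : ∀ k, 1 ≤ k → TriMask (i k) fun ξ => ‖mask (D k) ξ‖ ^ 2)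
    (hdiv : ∀ k, 2 ≤ k → ∀ j, 3 ∣ (R k).transpose.mulVec ![1, i k] j) (p : ℕ) :
    ∃ S', S ⊆ S' ∧ IsFiniteSpectrum R D (l + p) S' := by
  induction p with
  | zero => exact ⟨S, subset_rfl, hS⟩
  | succ p ih =>
    obtain ⟨S', h1, h2⟩ := ih
    obtain ⟨S'', h3, h4⟩ := h2.exists_succ hD hR (hT (l + p + 1) (by omega))
      (maskProd_add_dualProd_thirdVec hR hdiv (l + p))
    exact ⟨S'', h1.trans h3, h4⟩

/-- At a far enough level the old points are already rescaled into the cube and can stay in place;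
the new points are rounded into it by periods. -/
theorem ContractingMoran.exists_next_finiteSpectrum (h : ContractingMoran R D r B K)
    (hT : ∀ k, 1 ≤ k → TriMask (i k) fun ξ => ‖mask (D k) ξ‖ ^ 2)
    (hdiv : ∀ k, 2 ≤ k → ∀ j, 3 ∣ (R k).transpose.mulVec ![1, i k] j)
    {l : ℕ} {S : Finset (EuclideanSpace ℝ (Fin 2))} (hS : IsFiniteSpectrum R D l S) :
    ∃ l' S', l < l' ∧ S ⊆ S' ∧ IsFiniteSpectrum R D l' S' ∧
      ∀ x ∈ S', dualProdInv R 0 l' x ∈ cube 2 0 := by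
  classical
  have h1 : ∀ᶠ l' in atTop, ∀ x ∈ S, ‖dualProdInv R 0 l' x‖ < 1 / 2 := by
    rw [Filter.eventually_all_finset]
    intro x _
    exact (h.summable_norm_dualProdInv 0 x).tendsto_atTop_zero.eventually
      (gt_mem_nhds (by norm_num))
  obtain ⟨l', hl', hll'⟩ := (h1.and (eventually_gt_atTop l)).exists
  obtain ⟨p, rfl⟩ := Nat.exists_eq_add_of_lt hll'
  obtain ⟨S', hSS', hS'⟩ := hS.exists_add h.nonempty h.det_ne_zero hT hdiv (p + 1)
  rw [← add_assoc] at hS'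
  set l' := l + p + 1
  have hdet := dualProd_det_ne_zero h.det_ne_zero 0 l'
  set A := matMap (realMat (dualProd R 0 l')) with hA
  set ρ : EuclideanSpace ℝ (Fin 2) → Fin 2 → ℤ := fun x j => round (dualProdInv R 0 l' x j) with hρ
  set g : EuclideanSpace ℝ (Fin 2) → EuclideanSpace ℝ (Fin 2) := fun x =>
    if x ∈ S then x else x - A (intVec (ρ x)) with hg
  refine ⟨l', S'.image g, hll', fun x hx => ?_, hS'.image h.nonempty h.det_ne_zero fun x => ?_, ?_⟩
  · exact Finset.mem_image.2 ⟨x, hSS' hx, by simp [hg, hx]⟩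
  · by_cases hx : x ∈ S
    · refine ⟨0, ?_⟩
      have : intVec (0 : Fin 2 → ℤ) = 0 := by ext; simp [intVec]
      simp [hg, hx, this]
    · refine ⟨-ρ x, ?_⟩
      have : intVec (-ρ x) = -intVec (ρ x) := by ext; simp [intVec]
      simp only [hg, if_neg hx, this, map_neg, ← sub_eq_add_neg]
      rfl
  · intro y hy j
    obtain ⟨x, hx, rfl⟩ := Finset.mem_image.1 hy
    rw [Set.mem_Icc, sub_zero, add_zero, ← abs_le]
    by_cases hxS : x ∈ S
    · simp only [hg, if_pos hxS]
      exact (abs_apply_le_norm _ j).trans (hl' x hxS).le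
    · have h2 : dualProdInv R 0 l' (A (intVec (ρ x))) = intVec (ρ x) := matMap_inv_apply hdet _
      simp only [hg, if_neg hxS, map_sub, h2]
      exact abs_sub_round (dualProdInv R 0 l' x j)

/-- Dominated convergence for sums over an increasing sequence of finite sets. -/
theorem hasSum_indicator_iUnion_of_sum_eq_one {E : Type*} {S : ℕ → Finset E} (hS : Monotone S)
    {F : ℕ → E → ℝ} {P : E → ℝ} (hF0 : ∀ n x, 0 ≤ F n x) (hP0 : ∀ x, 0 ≤ P x)
    (hsum : Summable ((⋃ n, (S n : Set E)).indicator P))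
    (hlim : ∀ x, Tendsto (fun n => F n x) atTop (𝓝 (P x))) {C : ℝ} (hC : 0 ≤ C)
    (hdom : ∀ᶠ n in atTop, ∀ x ∈ S n, F n x ≤ C * P x) (hone : ∀ n, ∑ x ∈ S n, F n x = 1) :
    HasSum ((⋃ n, (S n : Set E)).indicator P) 1 := by
  classical
  have hmem : ∀ {n x}, x ∈ S n → x ∈ ⋃ n, (S n : Set E) := fun {n x} hx =>
    Set.mem_iUnion.2 ⟨n, hx⟩
  have ht : Tendsto (fun n => ∑' x, if x ∈ S n then F n x else 0) atTop
      (𝓝 (∑' x, (⋃ n, (S n : Set E)).indicator P x)) := by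
    refine tendsto_tsum_of_dominated_convergence (hsum.mul_left C) (fun x => ?_) ?_
    · by_cases hx : x ∈ ⋃ n, (S n : Set E)
      · rw [Set.indicator_of_mem hx]
        obtain ⟨a, ha⟩ := Set.mem_iUnion.1 hx
        refine (hlim x).congr' ?_
        filter_upwards [eventually_ge_atTop a] with n hn
        rw [if_pos (hS hn ha)]
      · rw [Set.indicator_of_notMem hx]
        refine tendsto_const_nhds.congr fun n => ?_
        rw [if_neg fun hn => hx (hmem hn)]
    · filter_upwards [hdom] with n hn x
      by_cases hx : x ∈ S n
      · rw [if_pos hx, Set.indicator_of_mem (hmem hx), Real.norm_of_nonneg (hF0 n x)]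
        exact hn x hx
      · rw [if_neg hx, norm_zero]
        exact mul_nonneg hC (Set.indicator_nonneg (fun _ _ => hP0 _) _)
  have h1 : ∀ n, ∑' x, (if x ∈ S n then F n x else 0) = 1 := fun n => by
    rw [← hone n, tsum_eq_sum (s := S n) fun x hx => if_neg hx]
    exact Finset.sum_congr rfl fun x hx => if_pos hx
  simp only [h1] at ht
  rw [tendsto_nhds_unique tendsto_const_nhds ht]
  exact hsum.hasSum

/-- An increasing sequence of spectra of finite convolutions whose rescalings lie in the unit cube
has a union that is a spectrum of the infinite convolution. -/
theorem ContractingMoran.isSpectrum_iUnion (h : ContractingMoran R D r B K) {δ : ℝ} (hδ : 0 < δ)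
    {c : ℝ} (hc : 0 < c) {k₀ : ℕ} (hlow : ∀ k, k₀ ≤ k → ∀ x ∈ cube 2 δ, c ≤ ‖maskLimit R D k x‖)
    {μ : Measure (EuclideanSpace ℝ (Fin 2))} [IsProbabilityMeasure μ]
    (hμ : fourierTr μ = maskLimit R D 0) {l : ℕ → ℕ} (hl : StrictMono l)
    {S : ℕ → Finset (EuclideanSpace ℝ (Fin 2))} (hS : Monotone S)
    (hfin : ∀ n, IsFiniteSpectrum R D (l n) (S n))
    (hcube : ∀ n, ∀ x ∈ S n, dualProdInv R 0 (l n) x ∈ cube 2 0) :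
    IsSpectrum μ (⋃ n, (S n : Set (EuclideanSpace ℝ (Fin 2)))) := by
  set Λ := ⋃ n, (S n : Set (EuclideanSpace ℝ (Fin 2))) with hΛ
  have horth : ∀ x ∈ Λ, ∀ y ∈ Λ, x ≠ y → maskLimit R D 0 (x - y) = 0 := by
    intro x hx y hy hxy
    obtain ⟨a, ha⟩ := Set.mem_iUnion.1 hx
    obtain ⟨b, hb⟩ := Set.mem_iUnion.1 hy
    have h1 := (hfin (max a b)).eq_zero h.nonempty (hS (le_max_left a b) ha)
      (hS (le_max_right a b) hb) hxy
    rw [h.maskLimit_eq_mul 0 (l (max a b)), h1, zero_mul]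
  refine isSpectrum_of_hasSum (Set.countable_iUnion fun n => (S n).countable_toSet)
    (by rw [hμ]; exact horth) fun ξ => ?_
  rw [hμ]
  suffices hind : HasSum (Λ.indicator fun x => ‖maskLimit R D 0 (ξ + x)‖ ^ 2) 1 from
    hasSum_subtype_iff_indicator.2 hind
  refine hasSum_indicator_iUnion_of_sum_eq_one hS
    (F := fun n x => ‖maskProd R D 0 (l n) (ξ + x)‖ ^ 2) (fun n x => by positivity)
    (fun x => by positivity) ?_ (fun x => ?_) (C := (c ^ 2)⁻¹) (by positivity) ?_
    fun n => hfin n ξ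
  · exact ((h.isBessel_maskLimit 0).summable_indicator (S := Λ)
      (fun x hx y hy hxy => by simp [horth x hx y hy hxy]) ξ).1
  · exact ((h.tendsto_maskProd 0 (ξ + x)).comp hl.tendsto_atTop).norm.pow 2
  · have h1 : ∀ᶠ n in atTop, ‖dualProdInv R 0 (l n) ξ‖ < δ :=
      ((h.summable_norm_dualProdInv 0 ξ).tendsto_atTop_zero.comp hl.tendsto_atTop).eventually
        (gt_mem_nhds hδ)
    filter_upwards [h1, hl.tendsto_atTop.eventually (eventually_ge_atTop k₀)] with n hn hk x hx
    -- The margin `δ` of the cube absorbs the rescaled `ξ`. Factoring the limit at level `l n` then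
    -- bounds the partial product by `c⁻¹` times the limit, which is the domination required.
    have h2 : c ≤ ‖maskLimit R D (l n) (dualProdInv R 0 (l n) (ξ + x))‖ := by
      refine hlow _ hk _ fun j => ?_
      have h3 := abs_le.1 ((abs_apply_le_norm (dualProdInv R 0 (l n) ξ) j).trans hn.le)
      have h4 := hcube n x hx j
      rw [Set.mem_Icc] at h4
      rw [map_add, PiLp.add_apply, Set.mem_Icc]
      constructor <;> linarith [h3.1, h3.2, h4.1, h4.2]
    have h5 : c ^ 2 ≤ ‖maskLimit R D (l n) (dualProdInv R 0 (l n) (ξ + x))‖ ^ 2 :=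
      pow_le_pow_left₀ hc.le h2 2
    rw [h.maskLimit_eq_mul 0 (l n), norm_mul, mul_pow, zero_add, inv_mul_eq_div,
      le_div_iff₀ (by positivity)]
    exact mul_le_mul_of_nonneg_left h5 (by positivity)

/-- If `(1, iₖ) Rₖ` is divisible by `3` for `k ≥ 2`, then the infinite convolution is spectral. -/
theorem ContractingMoran.isSpectralMeasure (h : ContractingMoran R D r B K)
    (hT : ∀ k, 1 ≤ k → TriMask (i k) fun ξ => ‖mask (D k) ξ‖ ^ 2)
    (hdiv : ∀ k, 2 ≤ k → ∀ j, 3 ∣ (R k).transpose.mulVec ![1, i k] j)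
    (hsep : MoranSeparated R D)
    {μ : Measure (EuclideanSpace ℝ (Fin 2))} [IsProbabilityMeasure μ]
    (hμ : fourierTr μ = maskLimit R D 0) : IsSpectralMeasure μ := by
  obtain ⟨δ, hδ, β, hβ, N, hadm⟩ := hsep
  simp only [dualProd_eq_list_prod] at hadm
  obtain ⟨c, hc, k₀, hlow⟩ := h.exists_le_norm_maskLimit hδ.2 hβ.1 hadm
  let X := {p : ℕ × Finset (EuclideanSpace ℝ (Fin 2)) //
    IsFiniteSpectrum R D p.1 p.2 ∧ ∀ x ∈ p.2, dualProdInv R 0 p.1 x ∈ cube 2 0}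
  have hnext : ∀ p : X, ∃ q : X, p.1.1 < q.1.1 ∧ p.1.2 ⊆ q.1.2 := fun p => by
    obtain ⟨l', S', h1, h2, h3, h4⟩ := h.exists_next_finiteSpectrum hT hdiv p.2.1
    exact ⟨⟨(l', S'), h3, h4⟩, h1, h2⟩
  choose next hlt hsub using hnext
  -- At level `0` the product is the constant `1`, so a single point satisfies Parseval.
  let start : X := ⟨(0, {0}), fun ξ => by simp [maskProd_zero], fun x hx j => by
    rw [Finset.mem_singleton.1 hx, map_zero]
    norm_num⟩
  let seq : ℕ → X := fun n => next^[n] start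
  have hsucc : ∀ n, seq (n + 1) = next (seq n) := fun n => Function.iterate_succ_apply' _ _ _
  exact ⟨_, h.isSpectrum_iUnion hδ.1 hc hlow hμ (l := fun n => (seq n).1.1)
    (S := fun n => (seq n).1.2) (strictMono_nat_of_lt_succ fun n => by rw [hsucc]; exact hlt _)
    (monotone_nat_of_le_succ fun n => by rw [hsucc]; exact hsub _) (fun n => (seq n).2.1)
    fun n => (seq n).2.2⟩

end sufficiency

theorem thirdRowIntegral_iff (i : ℕ) (A : Matrix (Fin 2) (Fin 2) ℤ) :
    ThirdRowIntegral i A ↔ ∀ j, 3 ∣ A.transpose.mulVec ![1, (i : ℤ)] j := by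
  have h : ∀ j, ((1 / 3 : ℝ) • Matrix.vecMul ![(1 : ℝ), (i : ℝ)] (realMat A)) j =
      (A.transpose.mulVec ![1, (i : ℤ)] j : ℝ) / 3 := fun j => by
    simp [Matrix.vecMul, Matrix.mulVec, dotProduct, Fin.sum_univ_two, realMat]
    ring
  constructor
  · rintro ⟨z, hz⟩ j
    refine ⟨z j, ?_⟩
    have h1 := congrFun hz j
    rw [h, div_eq_iff (by norm_num)] at h1
    rw [mul_comm (3 : ℤ)]
    exact_mod_cast h1
  · intro hd
    choose z hz using hd
    refine ⟨z, funext fun j => ?_⟩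
    rw [h, hz]
    push_cast; ring

end

/-! ### Assembly of the two directions -/

theorem triMask_of_mem_Gamma1 {a b c d : ℤ} (h : |a * d - b * c| = 1)
    (hm : triDigits a b c d ∈ Gamma1) :
    TriMask 1 fun ξ => ‖mask (triDigits a b c d) ξ‖ ^ 2 :=
  triMask_triDigits h ((mem_Gamma1_iff h).1 hm)

theorem triMask_of_mem_Gamma2 {a b c d : ℤ} (h : |a * d - b * c| = 1)
    (hm : triDigits a b c d ∈ Gamma2) :
    TriMask 2 fun ξ => ‖mask (triDigits a b c d) ξ‖ ^ 2 :=
  triMask_triDigits h ((mem_Gamma2_iff h).1 hm)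

theorem mainTheorem5 (R : ℕ → Matrix (Fin 2) (Fin 2) ℤ) (a b c d : ℕ → ℤ)
    (D : ℕ → Finset (Fin 2 → ℤ)) (hD : ∀ k, (D k).Nonempty)
    (hDdef : ∀ k, 1 ≤ k → D k = triDigits (a k) (b k) (c k) (d k))
    (hR : ∀ k, 1 ≤ k → IsExpanding (R k))
    (hGamma : ∀ k, 1 ≤ k → D k ∈ Gamma1 ∪ Gamma2)
    (hdet : ∀ k, 1 ≤ k → |a k * d k - b k * c k| = 1)
    (hbdd : MoranBounded R D)
    (hsep : MoranSeparated R D) :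
    (∃! μ, IsMoranMeasure R D hD μ) ∧
    ∀ μ, IsMoranMeasure R D hD μ →
      (IsSpectralMeasure (μ : MeasureTheory.Measure (EuclideanSpace ℝ (Fin 2))) ↔
        ∀ k, 2 ≤ k →
          (D k ∈ Gamma1 → ThirdRowIntegral 1 (R k)) ∧
          (D k ∈ Gamma2 → ThirdRowIntegral 2 (R k))) := by
  classical
  obtain ⟨r, B, K, h⟩ := hbdd.exists_contractingMoran (fun k hk => (hR k hk).det_ne_zero) hD
  have hT1 : ∀ k, 1 ≤ k → D k ∈ Gamma1 → TriMask 1 fun ξ => ‖mask (D k) ξ‖ ^ 2 :=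
    fun k hk hm => by
      rw [hDdef k hk] at hm ⊢
      exact triMask_of_mem_Gamma1 (hdet k hk) hm
  have hT2 : ∀ k, 1 ≤ k → D k ∈ Gamma2 → TriMask 2 fun ξ => ‖mask (D k) ξ‖ ^ 2 :=
    fun k hk hm => by
      rw [hDdef k hk] at hm ⊢
      exact triMask_of_mem_Gamma2 (hdet k hk) hm
  have hT : ∀ k, 1 ≤ k →
      TriMask (if D k ∈ Gamma1 then 1 else 2) fun ξ => ‖mask (D k) ξ‖ ^ 2 := fun k hk => by
    split_ifs with hm
    · exact hT1 k hk hm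
    · exact hT2 k hk ((hGamma k hk).resolve_left hm)
  -- Two index sequences, one preferring each class, give both divisibility claims without showing
  -- that the classes are disjoint.
  have hT' : ∀ k, 1 ≤ k →
      TriMask (if D k ∈ Gamma2 then 2 else 1) fun ξ => ‖mask (D k) ξ‖ ^ 2 := fun k hk => by
    split_ifs with hm
    · exact hT2 k hk hm
    · exact hT1 k hk ((hGamma k hk).resolve_right hm)
  refine ⟨?_, fun μ hμ => ?_⟩
  · obtain ⟨μ, hμ⟩ := h.exists_isMoranMeasure
    exact ⟨μ, hμ, fun ν hν => tendsto_nhds_unique hν hμ⟩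
  · have hF := h.isMoranMeasure_iff.1 hμ
    constructor
    · rintro ⟨Λ, hΛ⟩ k hk
      refine ⟨fun hm => (thirdRowIntegral_iff 1 _).2 fun j => ?_,
        fun hm => (thirdRowIntegral_iff 2 _).2 fun j => ?_⟩
      · have := h.three_dvd_of_isSpectrum hT hF hΛ hk j
        rwa [if_pos hm] at this
      · have := h.three_dvd_of_isSpectrum hT' hF hΛ hk j
        rwa [if_pos hm] at this
    · intro hint
      refine h.isSpectralMeasure hT (fun k hk j => ?_) hsep hF
      by_cases hm : D k ∈ Gamma1
      · rw [if_pos hm]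
        exact (thirdRowIntegral_iff 1 _).1 ((hint k hk).1 hm) j
      · rw [if_neg hm]
        exact (thirdRowIntegral_iff 2 _).1
          ((hint k hk).2 ((hGamma k (by omega)).resolve_left hm)) j
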